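/- **Conventions.** An *operator space* is a complete matrix normed complex vector space satisfying Ruan's axioms. An *operator algebra* is a norm-closed (not necessarily unital) subalgebra $A\subseteq B(H)$, $H$ a complex Hilbert space, that contains a contractive two-sided approximate identity; $M_n(A)\subseteq M_n(B(H))=B(H^n)$ carries the operator norm. A *non-degenerate right operator $A$-module* is an operator space $E$ with a right $A$-module structure (compatible with the complex scalars) such that the induced map $E\otimes_h A\to E$ on the Haagerup tensor product is completely contractive and the elements $x\cdot a$ ($x\in E$, $a\in A$) span a dense subspace of $E$. Let $\mathrm{OMOD}_A^\infty$ be the category of these modules with the completely bounded $A$-module maps as morphisms, let $\mathrm{Op}^\infty$ be the category of operator spaces with the completely bounded linear maps, and let $U\colon \mathrm{OMOD}_A^\infty\to\mathrm{Op}^\infty$ be the forgetful functor. In an additive category, a *kernel–cokernel pair* is a composable pair $(\mu,\pi)$ such that $\mu$ is a kernel of $\pi$ and $\pi$ is a cokernel of $\mu$. It is *split* if there are morphisms $r,s$ in the opposite directions with $r\mu=\mathrm{id}$, $\pi s=\mathrm{id}$ and $\mu r+s\pi=\mathrm{id}$. An *exact structure* is a class $\mathcal E$ of kernel–cokernel pairs,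 closed under isomorphisms, such that, calling first components of pairs in $\mathcal E$ admissible monomorphisms and second components admissible epimorphisms: all identities are admissible monomorphisms and admissible epimorphisms; admissible monomorphisms and admissible epimorphisms are each closed under composition; the pushout of an admissible monomorphism along any morphism exists and yields an admissible monomorphism; the pullback of an admissible epimorphism along any morphism exists and yields an admissible epimorphism. An *exact category* is an additive category together with an exact structure. An additive functor between exact categories is *exact* if it maps the pairs of the first exact structure to pairs of the second. Write $\mathcal E_{\max}$ for the class of all kernel–cokernel pairs and $\mathcal E_{\min}$ for the class of all split kernel–cokernel pairs. **Proposition.** Let $A$ be an operator algebra, and let $\mathcal E_{\mathrm{rel}}$ be the class of kernel–cokernel pairs $(\mu,\pi)$ in $\mathrm{OMOD}_A^\infty$ such that $(U\mu,U\pi)$ splits in $\mathrm{Op}^\infty$. Then $(\mathrm{OMOD}_A^\infty,\mathcal E_{\mathrm{rel}})$ is an exact category. Moreover, $\mathcal E_{\mathrm{rel}}$ is the relative exact structure induced by $\mathcal E_{\min}$ through the forgetful functor: $(\mathrm{OMOD}_A^\infty,\mathcal E_{\max})$, $(\mathrm{Op}^\infty,\mathcal E_{\max})$ and $(\mathrm{Op}^\infty,\mathcal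 E_{\min})$ are exact categories, the functor $U\colon(\mathrm{OMOD}_A^\infty,\mathcal E_{\max})\to(\mathrm{Op}^\infty,\mathcal E_{\max})$ is exact, and $$\mathcal E_{\mathrm{rel}}=\{(\mu,\pi)\in\mathcal E_{\max} : (U\mu,U\pi)\in\mathcal E_{\min}\}.$$ -/

import Mathlib

universe u w

namespace OpMod

section OperatorSpaces

/-- The data of a matrix norm: a real number for every square matrix over `E`. -/
class MatrixNorm (E : Type*) where
  /-- The norm on `M_n(E)`. -/
  mnorm : ∀ n : ℕ, Matrix (Fin n) (Fin n) E → ℝ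

/-- The product `α x β` of a scalar matrix, a matrix over `E` and a scalar matrix. -/
def scalarMulMul {E : Type*} [AddCommGroup E] [Module ℂ E] {n m : ℕ}
    (α : Matrix (Fin n) (Fin m) ℂ) (x : Matrix (Fin m) (Fin m) E)
    (β : Matrix (Fin m) (Fin n) ℂ) : Matrix (Fin n) (Fin n) E :=
  Matrix.of fun i j => ∑ k, ∑ l, (α i k * β l j) • x k l

/-- The diagonal direct sum `x ⊕ y ∈ M_{m+n}(E)` of `x ∈ M_m(E)` and `y ∈ M_n(E)`. -/
def directSum {E : Type*} [AddCommGroup E] {m n : ℕ}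
    (x : Matrix (Fin m) (Fin m) E) (y : Matrix (Fin n) (Fin n) E) :
    Matrix (Fin (m + n)) (Fin (m + n)) E :=
  Matrix.reindex finSumFinEquiv finSumFinEquiv (Matrix.fromBlocks x 0 0 y)

open scoped Matrix.Norms.L2Operator in
/-- A (complete, abstract) operator space: a complex Banach space `E` with a norm on every
`M_n(E)` such that `M_1(E) = E` isometrically and Ruan's two axioms hold. Scalar matrices carry
the operator norm of maps between finite-dimensional Hilbert spaces. -/
class OperatorSpace (E : Type*) [NormedAddCommGroup E] [NormedSpace ℂ E]
    extends MatrixNorm E, CompleteSpace E where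
  mnorm_add_le : ∀ (n : ℕ) (x y : Matrix (Fin n) (Fin n) E),
    mnorm n (x + y) ≤ mnorm n x + mnorm n y
  mnorm_smul : ∀ (n : ℕ) (c : ℂ) (x : Matrix (Fin n) (Fin n) E),
    mnorm n (c • x) = ‖c‖ * mnorm n x
  eq_zero_of_mnorm : ∀ (n : ℕ) (x : Matrix (Fin n) (Fin n) E), mnorm n x = 0 → x = 0
  mnorm_one : ∀ x : E, mnorm 1 (Matrix.of fun _ _ => x) = ‖x‖
  mnorm_directSum : ∀ (m n : ℕ) (x : Matrix (Fin m) (Fin m) E) (y : Matrix (Fin n) (Fin n) E),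
    mnorm (m + n) (directSum x y) = max (mnorm m x) (mnorm n y)
  mnorm_scalarMulMul_le : ∀ (n m : ℕ) (α : Matrix (Fin n) (Fin m) ℂ)
    (x : Matrix (Fin m) (Fin m) E) (β : Matrix (Fin m) (Fin n) ℂ),
    mnorm n (scalarMulMul α x β) ≤ ‖α‖ * mnorm m x * ‖β‖

/-- The norm of a rectangular matrix `x ∈ M_{m,n}(E)`, viewed as a corner of a square matrix
that is zero elsewhere. -/
def rectNorm {E : Type*} [AddCommGroup E] [MatrixNorm E] {m n : ℕ}
    (x : Matrix (Fin m) (Fin n) E) : ℝ :=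
  MatrixNorm.mnorm (m + n)
    (Matrix.reindex finSumFinEquiv finSumFinEquiv
      (Matrix.fromBlocks 0 x 0 0 : Matrix (Fin m ⊕ Fin n) (Fin m ⊕ Fin n) E))

open scoped TensorProduct in
/-- The matrix `x ⊙ y ∈ M_n(E ⊗ F)` with entries `∑ k, x i k ⊗ y k j`. -/
noncomputable def matTensor {E F : Type*} [AddCommGroup E] [Module ℂ E] [AddCommGroup F]
    [Module ℂ F] {n p : ℕ} (x : Matrix (Fin n) (Fin p) E) (y : Matrix (Fin p) (Fin n) F) :
    Matrix (Fin n) (Fin n) (E ⊗[ℂ] F) :=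
  Matrix.of fun i j => ∑ k, x i k ⊗ₜ[ℂ] y k j

open scoped TensorProduct in
/-- The Haagerup norm on `M_n(E ⊗ F)`: the infimum of `‖x‖ ‖y‖` over all `p` and all
`x ∈ M_{n,p}(E)`, `y ∈ M_{p,n}(F)` with `u = x ⊙ y`. The infimum is taken in `[0, ∞]`; it is
finite because such a factorisation always exists. -/
noncomputable def haagerupNorm {E F : Type*} [AddCommGroup E] [Module ℂ E] [MatrixNorm E]
    [AddCommGroup F] [Module ℂ F] [MatrixNorm F] {n : ℕ}
    (u : Matrix (Fin n) (Fin n) (E ⊗[ℂ] F)) : ENNReal :=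
  ⨅ (p : ℕ) (x : Matrix (Fin n) (Fin p) E) (y : Matrix (Fin p) (Fin n) F)
    (_ : u = matTensor x y), ENNReal.ofReal (rectNorm x * rectNorm y)

/-- A linear map is completely bounded if its amplifications to all `M_n` are uniformly
bounded. -/
def IsCompletelyBounded {E F : Type*} [AddCommGroup E] [Module ℂ E] [MatrixNorm E]
    [AddCommGroup F] [Module ℂ F] [MatrixNorm F] (f : E →ₗ[ℂ] F) : Prop :=
  ∃ C : ℝ, ∀ (n : ℕ) (x : Matrix (Fin n) (Fin n) E),
    MatrixNorm.mnorm n (x.map f) ≤ C * MatrixNorm.mnorm n x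

lemma mnorm_zero {E : Type*} [NormedAddCommGroup E] [NormedSpace ℂ E] [OperatorSpace E]
    (n : ℕ) : MatrixNorm.mnorm n (0 : Matrix (Fin n) (Fin n) E) = 0 := by
  simpa using OperatorSpace.mnorm_smul n 0 (0 : Matrix (Fin n) (Fin n) E)

lemma mnorm_nonneg {E : Type*} [NormedAddCommGroup E] [NormedSpace ℂ E] [OperatorSpace E]
    (n : ℕ) (x : Matrix (Fin n) (Fin n) E) : 0 ≤ MatrixNorm.mnorm n x := by
  have h1 := OperatorSpace.mnorm_add_le n x ((-1 : ℂ) • x)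
  have h2 := OperatorSpace.mnorm_smul n (-1) x
  have h3 : x + (-1 : ℂ) • x = 0 := by simp
  rw [h3, mnorm_zero, h2, norm_neg, norm_one] at h1
  linarith

/-- `CB(E, F)`, the space of completely bounded linear maps. -/
def CB (E F : Type*) [NormedAddCommGroup E] [NormedSpace ℂ E] [OperatorSpace E]
    [NormedAddCommGroup F] [NormedSpace ℂ F] [OperatorSpace F] : Submodule ℂ (E →ₗ[ℂ] F) where
  carrier := {f | IsCompletelyBounded f}
  zero_mem' := ⟨0, fun n x => by
    have h : x.map (0 : E →ₗ[ℂ] F) = 0 := by ext; simp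
    rw [h, mnorm_zero, zero_mul]⟩
  add_mem' := by
    rintro f g ⟨C, hC⟩ ⟨D, hD⟩
    refine ⟨C + D, fun n x => ?_⟩
    have h : x.map (f + g : E →ₗ[ℂ] F) = x.map f + x.map g := by ext; simp
    rw [h, add_mul]
    exact (OperatorSpace.mnorm_add_le n _ _).trans (add_le_add (hC n x) (hD n x))
  smul_mem' := by
    rintro c f ⟨C, hC⟩
    refine ⟨‖c‖ * C, fun n x => ?_⟩
    have h : x.map (c • f : E →ₗ[ℂ] F) = c • x.map f := by ext; simp
    rw [h, OperatorSpace.mnorm_smul, mul_assoc]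
    exact mul_le_mul_of_nonneg_left (hC n x) (norm_nonneg c)

lemma id_mem_CB (E : Type*) [NormedAddCommGroup E] [NormedSpace ℂ E] [OperatorSpace E] :
    LinearMap.id ∈ CB E E :=
  ⟨1, fun n x => by
    have h : x.map (LinearMap.id : E →ₗ[ℂ] E) = x := by ext; simp
    rw [h, one_mul]⟩

lemma comp_mem_CB {E F G : Type*} [NormedAddCommGroup E] [NormedSpace ℂ E] [OperatorSpace E]
    [NormedAddCommGroup F] [NormedSpace ℂ F] [OperatorSpace F]
    [NormedAddCommGroup G] [NormedSpace ℂ G] [OperatorSpace G]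
    {f : E →ₗ[ℂ] F} {g : F →ₗ[ℂ] G} (hf : f ∈ CB E F) (hg : g ∈ CB F G) :
    g ∘ₗ f ∈ CB E G := by
  obtain ⟨C, hC⟩ := hf
  obtain ⟨D, hD⟩ := hg
  refine ⟨|D| * C, fun n x => ?_⟩
  have h : x.map (g ∘ₗ f) = (x.map f).map g := by ext; simp
  rw [h, mul_assoc]
  calc MatrixNorm.mnorm n ((x.map f).map g) ≤ D * MatrixNorm.mnorm n (x.map f) := hD n _
    _ ≤ |D| * MatrixNorm.mnorm n (x.map f) :=
        mul_le_mul_of_nonneg_right (le_abs_self D) (mnorm_nonneg n _)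
    _ ≤ |D| * (C * MatrixNorm.mnorm n x) :=
        mul_le_mul_of_nonneg_left (hC n x) (abs_nonneg D)

end OperatorSpaces

section OperatorAlgebras

/-- An operator algebra on the Hilbert space `H`: a norm-closed subalgebra of `B(H)` (not
necessarily unital) that contains a contractive (two-sided) approximate identity. -/
structure OperatorAlgebra (H : Type*) [NormedAddCommGroup H] [InnerProductSpace ℂ H]
    [CompleteSpace H] where
  /-- The underlying subalgebra of `B(H)`. -/
  alg : NonUnitalSubalgebra ℂ (H →L[ℂ] H)
  isClosed : IsClosed (alg : Set (H →L[ℂ] H))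
  exists_cai : ∃ l : Filter alg, l.IsApproximateUnit ∧ ∀ᶠ e in l, ‖e‖ ≤ 1

variable {H : Type*} [NormedAddCommGroup H] [InnerProductSpace ℂ H] [CompleteSpace H]

/-- The operator on the Hilbert space `H^n` given by a matrix of operators on `H`. -/
noncomputable def matrixToCLM {n : ℕ} (a : Matrix (Fin n) (Fin n) (H →L[ℂ] H)) :
    PiLp 2 (fun _ : Fin n => H) →L[ℂ] PiLp 2 (fun _ : Fin n => H) :=
  (PiLp.continuousLinearEquiv 2 ℂ (fun _ : Fin n => H)).symm.toContinuousLinearMap ∘L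
    ContinuousLinearMap.pi fun i => ∑ j, a i j ∘L PiLp.proj 2 (fun _ : Fin n => H) j

/-- The canonical matrix norm of an operator algebra: `M_n(A) ⊆ M_n(B(H)) = B(H^n)`. -/
noncomputable instance (A : OperatorAlgebra H) : MatrixNorm A.alg where
  mnorm _ a := ‖matrixToCLM (a.map Subtype.val)‖

open scoped TensorProduct in
/-- A non-degenerate right operator `A`-module structure on the operator space `E`: an
associative bilinear right action whose induced map `E ⊗ A → E` is completely contractive for the
Haagerup norm (equivalently, as `E` is complete, its continuous extension to the completed
Haagerup tensor product is completely contractive), such that the elements `x · a` span a dense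
subspace. -/
class OperatorModule (A : OperatorAlgebra H) (E : Type*) [NormedAddCommGroup E]
    [NormedSpace ℂ E] [OperatorSpace E] where
  /-- The right action `act x a = x · a`. -/
  act : E →ₗ[ℂ] A.alg →ₗ[ℂ] E
  act_mul : ∀ (x : E) (a b : A.alg), act x (a * b) = act (act x a) b
  completelyContractive : ∀ (n : ℕ) (u : Matrix (Fin n) (Fin n) (E ⊗[ℂ] A.alg)),
    ENNReal.ofReal (MatrixNorm.mnorm n (u.map (TensorProduct.lift act))) ≤ haagerupNorm u
  nondegenerate : Dense (Submodule.span ℂ {y : E | ∃ x a, y = act x a} : Set E)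

/-- `CB_A(E, F)`, the completely bounded `A`-module maps. -/
def CBmod (A : OperatorAlgebra H) (E F : Type*) [NormedAddCommGroup E] [NormedSpace ℂ E]
    [OperatorSpace E] [OperatorModule A E] [NormedAddCommGroup F] [NormedSpace ℂ F]
    [OperatorSpace F] [OperatorModule A F] : Submodule ℂ (E →ₗ[ℂ] F) where
  carrier := {f | f ∈ CB E F ∧ ∀ (x : E) (a : A.alg),
    f (OperatorModule.act x a) = OperatorModule.act (f x) a}
  zero_mem' := ⟨(CB E F).zero_mem, fun x a => by simp⟩
  add_mem' hf hg := ⟨(CB E F).add_mem hf.1 hg.1, fun x a => by simp [hf.2, hg.2]⟩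
  smul_mem' c _ hf := ⟨(CB E F).smul_mem c hf.1, fun x a => by simp [hf.2]⟩

end OperatorAlgebras

section Categories

open CategoryTheory

/-- Operator spaces, as objects of the category `Op`. -/
structure Op : Type (u + 1) where
  carrier : Type u
  [normedAddCommGroup : NormedAddCommGroup carrier]
  [normedSpace : NormedSpace ℂ carrier]
  [operatorSpace : OperatorSpace carrier]

attribute [instance] Op.normedAddCommGroup Op.normedSpace Op.operatorSpace

/-- The category of operator spaces and completely bounded linear maps. -/
instance : Category Op.{u} where
  Hom E F := CB E.carrier F.carrier
  id E := ⟨LinearMap.id, id_mem_CB E.carrier⟩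
  comp f g := ⟨g.1 ∘ₗ f.1, comp_mem_CB f.2 g.2⟩

instance : Preadditive Op.{u} where
  homGroup E F := inferInstanceAs (AddCommGroup (CB E.carrier F.carrier))
  add_comp _ _ _ f f' g := Subtype.ext (LinearMap.comp_add f.1 f'.1 g.1)
  comp_add _ _ _ f g g' := Subtype.ext (LinearMap.add_comp f.1 g'.1 g.1)

variable {H : Type*} [NormedAddCommGroup H] [InnerProductSpace ℂ H] [CompleteSpace H]

/-- Non-degenerate right operator `A`-modules, as objects of the category `OMod A`. -/
structure OMod (A : OperatorAlgebra H) where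
  carrier : Type u
  [normedAddCommGroup : NormedAddCommGroup carrier]
  [normedSpace : NormedSpace ℂ carrier]
  [operatorSpace : OperatorSpace carrier]
  [operatorModule : OperatorModule A carrier]

attribute [instance] OMod.normedAddCommGroup OMod.normedSpace OMod.operatorSpace
  OMod.operatorModule

/-- The category of non-degenerate right operator `A`-modules and completely bounded `A`-module
maps. -/
instance (A : OperatorAlgebra H) : Category (OMod.{u} A) where
  Hom E F := CBmod A E.carrier F.carrier
  id E := ⟨LinearMap.id, id_mem_CB E.carrier, fun _ _ => rfl⟩
  comp f g := ⟨g.1 ∘ₗ f.1, comp_mem_CB f.2.1 g.2.1, fun x a =>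
    (congrArg g.1 (f.2.2 x a)).trans (g.2.2 (f.1 x) a)⟩

instance (A : OperatorAlgebra H) : Preadditive (OMod.{u} A) where
  homGroup E F := inferInstanceAs (AddCommGroup (CBmod A E.carrier F.carrier))
  add_comp _ _ _ f f' g := Subtype.ext (LinearMap.comp_add f.1 f'.1 g.1)
  comp_add _ _ _ f g g' := Subtype.ext (LinearMap.add_comp f.1 g'.1 g.1)

/-- The functor that forgets the module action. -/
def forget (A : OperatorAlgebra H) : OMod.{u} A ⥤ Op.{u} where
  obj E := ⟨E.carrier⟩
  map f := ⟨f.1, f.2.1⟩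

instance (A : OperatorAlgebra H) : (forget.{u} A).Additive where
  map_add := rfl

end Categories

section ExactCategories

open CategoryTheory CategoryTheory.Limits

variable {C : Type*} [Category* C] [Preadditive C]

/-- A composable pair `(μ, π)` with `μ ≫ π = 0` is a kernel-cokernel pair if `μ` is a kernel of
`π` and `π` is a cokernel of `μ`. -/
def IsKernelCokernelPair (S : ShortComplex C) : Prop :=
  Nonempty (IsLimit (KernelFork.ofι S.f S.zero)) ∧
    Nonempty (IsColimit (CokernelCofork.ofπ S.g S.zero))

/-- `μ` is an admissible monomorphism for the class `E`: `(μ, π) ∈ E` for some `π`. -/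
def AdmissibleMono (E : ObjectProperty (ShortComplex C)) {X Y : C} (μ : X ⟶ Y) : Prop :=
  ∃ (Z : C) (π : Y ⟶ Z) (w : μ ≫ π = 0), E (ShortComplex.mk μ π w)

/-- `π` is an admissible epimorphism for the class `E`: `(μ, π) ∈ E` for some `μ`. -/
def AdmissibleEpi (E : ObjectProperty (ShortComplex C)) {Y Z : C} (π : Y ⟶ Z) : Prop :=
  ∃ (X : C) (μ : X ⟶ Y) (w : μ ≫ π = 0), E (ShortComplex.mk μ π w)

/-- An exact structure (in the sense of Quillen): a class of kernel-cokernel pairs, closed under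
isomorphisms, satisfying the axioms E0, E1, E2 and their duals. -/
structure IsExactStructure (E : ObjectProperty (ShortComplex C)) : Prop where
  isKernelCokernelPair : ∀ S : ShortComplex C, E S → IsKernelCokernelPair S
  of_iso : ∀ S T : ShortComplex C, Nonempty (S ≅ T) → E S → E T
  id_mono : ∀ X : C, AdmissibleMono E (𝟙 X)
  id_epi : ∀ X : C, AdmissibleEpi E (𝟙 X)
  comp_mono : ∀ {X Y Z : C} (f : X ⟶ Y) (g : Y ⟶ Z),
    AdmissibleMono E f → AdmissibleMono E g → AdmissibleMono E (f ≫ g)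
  comp_epi : ∀ {X Y Z : C} (f : X ⟶ Y) (g : Y ⟶ Z),
    AdmissibleEpi E f → AdmissibleEpi E g → AdmissibleEpi E (f ≫ g)
  pushout : ∀ {X Y Z : C} (f : X ⟶ Y) (g : X ⟶ Z), AdmissibleMono E f →
    HasPushout f g ∧ ∀ {P : C} (inl : Y ⟶ P) (inr : Z ⟶ P),
      IsPushout f g inl inr → AdmissibleMono E inr
  pullback : ∀ {X Y Z : C} (f : X ⟶ Z) (g : Y ⟶ Z), AdmissibleEpi E f →
    HasPullback f g ∧ ∀ {P : C} (fst : P ⟶ X) (snd : P ⟶ Y),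
      IsPullback fst snd f g → AdmissibleEpi E snd

/-- `(C, E)` is an exact category: `C` is additive (it has a zero object and binary products, on
top of its preadditive structure) and `E` is an exact structure on `C`. -/
structure IsExactCategory (E : ObjectProperty (ShortComplex C)) : Prop where
  hasZeroObject : HasZeroObject C
  hasBinaryProducts : HasBinaryProducts C
  isExactStructure : IsExactStructure E

variable (C) in
/-- The class of all kernel-cokernel pairs. -/
def Emax : ObjectProperty (ShortComplex C) := fun S => IsKernelCokernelPair S

variable (C) in
/-- The class of all split kernel-cokernel pairs. -/
def Emin : ObjectProperty (ShortComplex C) := fun S =>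
  IsKernelCokernelPair S ∧ Nonempty S.Splitting

variable {D : Type*} [Category* D] [Preadditive D]

/-- The additive functor `F : (C, E₁) ⥤ (D, E₂)` between exact categories is exact. -/
structure IsExactFunctor (F : C ⥤ D) [F.Additive] (E₁ : ObjectProperty (ShortComplex C))
    (E₂ : ObjectProperty (ShortComplex D)) : Prop where
  source : IsExactCategory E₁
  target : IsExactCategory E₂
  map_mem : ∀ S : ShortComplex C, E₁ S → E₂ (S.map F)

/-- The class of all `(μ, π) ∈ E₁` with `(F μ, F π) ∈ E₂'`. -/
def relativeClass (F : C ⥤ D) [F.Additive] (E₁ : ObjectProperty (ShortComplex C))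
    (E₂' : ObjectProperty (ShortComplex D)) : ObjectProperty (ShortComplex C) :=
  fun S => E₁ S ∧ E₂' (S.map F)

end ExactCategories

section Relative

open CategoryTheory

variable {H : Type*} [NormedAddCommGroup H] [InnerProductSpace ℂ H] [CompleteSpace H]

/-- The class of kernel-cokernel pairs of operator `A`-modules that split as pairs of completely
bounded maps of operator spaces. -/
def Erel (A : OperatorAlgebra H) : ObjectProperty (ShortComplex (OMod.{u} A)) :=
  fun S => IsKernelCokernelPair S ∧ Nonempty (S.map (forget A)).Splitting

end Relative

end OpMod

namespace OpMod

/-! ### Ruan's axioms applied to submatrices and corners. -/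

section MatrixBounds

open scoped Matrix.Norms.L2Operator

/-! The forgetful functor `U` preserves kernels and cokernels and reflects isomorphisms, so whether
a pair of modules is a kernel–cokernel pair can be tested on operator spaces
(`isKernelCokernelPair_map_iff`). Hence `Emax` and `Erel` on modules are the preimages under `U` of
`Emax` and `Emin` on `Op`, and everything reduces to two exact structures on `Op` and a transfer
principle (`isExactCategory_comap`): for such a `U`, admissibility of `f` depends only on `U f`, and
`U` preserves pushouts and pullbacks.

That `U` preserves kernels and cokernels means that kernels (closed subspaces) and cokernels
(quotients by the closure of the range) of module maps are again non-degenerate operator modules.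
Non-degeneracy of a closed submodule is where the contractive approximate identity matters: `x · e →
x` for every `x` (`tendsto_act`), so `x` is a limit of products formed inside the submodule.

On `Op`, the axioms for `Emin` are formal: admissible monomorphisms and epimorphisms are the split
ones. For `Emax` they are analytic: the admissible monomorphisms are the maps completely bounded
below, and the admissible epimorphisms are the completely open maps. Both classes are closed under
composition, and explicit models inside or below `Y × Z` give stability under pushout and pullback.
-/

lemma norm_one_submatrix_le {m n : ℕ} {σ : Fin m → Fin n} (hσ : Function.Injective σ) :
    ‖(1 : Matrix (Fin n) (Fin n) ℂ).submatrix σ id‖ ≤ 1 := by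
  -- The rows are distinct unit vectors, so `P P* = 1`, and the C*-identity turns this into `‖P‖² =
  -- ‖1‖`.
  have h : (1 : Matrix (Fin n) (Fin n) ℂ).submatrix σ id *
      ((1 : Matrix (Fin n) (Fin n) ℂ).submatrix σ id).conjTranspose = 1 := by
    rw [Matrix.conjTranspose_submatrix, Matrix.conjTranspose_one,
      ← Matrix.submatrix_mul _ _ σ id σ Function.bijective_id, one_mul]
    exact Matrix.submatrix_one σ hσ
  have h2 := Matrix.l2_opNorm_conjTranspose_mul_self
    (((1 : Matrix (Fin n) (Fin n) ℂ).submatrix σ id).conjTranspose)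
  rw [Matrix.conjTranspose_conjTranspose, h, Matrix.l2_opNorm_conjTranspose] at h2
  -- Only an inequality: for `m = 0` the identity matrix has norm `0`.
  have h3 : ‖(1 : Matrix (Fin m) (Fin m) ℂ)‖ ≤ 1 := by
    rw [← Matrix.diagonal_one, Matrix.l2_opNorm_diagonal]
    exact (pi_norm_le_iff_of_nonneg zero_le_one).2 fun i => by simp
  nlinarith [norm_nonneg ((1 : Matrix (Fin n) (Fin n) ℂ).submatrix σ id)]

lemma norm_one_submatrix_le' {m n : ℕ} {σ : Fin m → Fin n} (hσ : Function.Injective σ) :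
    ‖(1 : Matrix (Fin n) (Fin n) ℂ).submatrix id σ‖ ≤ 1 := by
  have h := norm_one_submatrix_le hσ
  rwa [← Matrix.l2_opNorm_conjTranspose, Matrix.conjTranspose_submatrix,
    Matrix.conjTranspose_one] at h

/-- Selecting rows and columns is multiplication by scalar selection matrices, which brings
submatrices under Ruan's second axiom. -/
lemma scalarMulMul_one_submatrix {E : Type*} [AddCommGroup E] [Module ℂ E] {n m : ℕ}
    (x : Matrix (Fin m) (Fin m) E) (σ τ : Fin n → Fin m) :
    scalarMulMul ((1 : Matrix (Fin m) (Fin m) ℂ).submatrix σ id) x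
      ((1 : Matrix (Fin m) (Fin m) ℂ).submatrix id τ) = x.submatrix σ τ := by
  ext i j
  have h : ∀ k l, (((1 : Matrix (Fin m) (Fin m) ℂ).submatrix σ id i k *
      (1 : Matrix (Fin m) (Fin m) ℂ).submatrix id τ l j) • x k l) =
      if k = σ i then if l = τ j then x k l else 0 else 0 := fun k l => by
    rw [Matrix.submatrix_apply, Matrix.submatrix_apply, Matrix.one_apply, Matrix.one_apply]
    simp only [id_eq, eq_comm (a := σ i)]
    split_ifs <;> simp
  simp only [scalarMulMul, Matrix.of_apply, h]
  simp

lemma map_scalarMulMul {E F : Type*} [AddCommGroup E] [Module ℂ E] [AddCommGroup F] [Module ℂ F]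
    (f : E →ₗ[ℂ] F) {n m : ℕ} (α : Matrix (Fin n) (Fin m) ℂ) (x : Matrix (Fin m) (Fin m) E)
    (β : Matrix (Fin m) (Fin n) ℂ) :
    (scalarMulMul α x β).map f = scalarMulMul α (x.map f) β := by
  ext i j; simp [scalarMulMul, map_sum]

lemma map_directSum {E F : Type*} [AddCommGroup E] [Module ℂ E] [AddCommGroup F] [Module ℂ F]
    (f : E →ₗ[ℂ] F) {m n : ℕ} (x : Matrix (Fin m) (Fin m) E) (y : Matrix (Fin n) (Fin n) E) :
    (directSum x y).map f = directSum (x.map f) (y.map f) := by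
  simp only [directSum, Matrix.reindex_apply, ← Matrix.submatrix_map, Matrix.fromBlocks_map]
  simp [Matrix.map_zero]

/-- Embedding of a rectangular matrix as the upper right corner of a square matrix. -/
def corner {E : Type*} [AddCommGroup E] {m n : ℕ} (x : Matrix (Fin m) (Fin n) E) :
    Matrix (Fin (m + n)) (Fin (m + n)) E :=
  Matrix.reindex finSumFinEquiv finSumFinEquiv
    (Matrix.fromBlocks 0 x 0 0 : Matrix (Fin m ⊕ Fin n) (Fin m ⊕ Fin n) E)

lemma map_corner {E F : Type*} [AddCommGroup E] [Module ℂ E] [AddCommGroup F] [Module ℂ F]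
    (f : E →ₗ[ℂ] F) {m n : ℕ} (x : Matrix (Fin m) (Fin n) E) :
    (corner x).map f = corner (x.map f) := by
  simp only [corner, Matrix.reindex_apply, ← Matrix.submatrix_map, Matrix.fromBlocks_map]
  simp [Matrix.map_zero]

lemma rectNorm_eq {E : Type*} [AddCommGroup E] [MatrixNorm E] {m n : ℕ}
    (x : Matrix (Fin m) (Fin n) E) : rectNorm x = MatrixNorm.mnorm (m + n) (corner x) := rfl

variable {E : Type*} [NormedAddCommGroup E] [NormedSpace ℂ E] [OperatorSpace E]

open OperatorSpace in
lemma mnorm_scalarMulMul_le_of_le_one {n m : ℕ} {α : Matrix (Fin n) (Fin m) ℂ}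
    (x : Matrix (Fin m) (Fin m) E) {β : Matrix (Fin m) (Fin n) ℂ} (hα : ‖α‖ ≤ 1)
    (hβ : ‖β‖ ≤ 1) :
    MatrixNorm.mnorm n (scalarMulMul α x β) ≤ MatrixNorm.mnorm m x := by
  have h0 := mnorm_nonneg m x
  calc MatrixNorm.mnorm n (scalarMulMul α x β) ≤ ‖α‖ * MatrixNorm.mnorm m x * ‖β‖ :=
        mnorm_scalarMulMul_le n m α x β
    _ ≤ 1 * MatrixNorm.mnorm m x * 1 := by gcongr
    _ = MatrixNorm.mnorm m x := by ring

lemma mnorm_submatrix_le {n m : ℕ} (x : Matrix (Fin m) (Fin m) E) {σ τ : Fin n → Fin m}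
    (hσ : Function.Injective σ) (hτ : Function.Injective τ) :
    MatrixNorm.mnorm n (x.submatrix σ τ) ≤ MatrixNorm.mnorm m x := by
  rw [← scalarMulMul_one_submatrix]
  exact mnorm_scalarMulMul_le_of_le_one x (norm_one_submatrix_le hσ) (norm_one_submatrix_le' hτ)

lemma norm_apply_le_mnorm {n : ℕ} (x : Matrix (Fin n) (Fin n) E) (i j : Fin n) :
    ‖x i j‖ ≤ MatrixNorm.mnorm n x := by
  rw [← OperatorSpace.mnorm_one]
  exact mnorm_submatrix_le (n := 1) x (σ := fun _ => i) (τ := fun _ => j)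
    (Function.injective_of_subsingleton _) (Function.injective_of_subsingleton _)

lemma rectNorm_nonneg {m n : ℕ} (x : Matrix (Fin m) (Fin n) E) : 0 ≤ rectNorm x :=
  mnorm_nonneg _ _

/-- Cutting out the upper right corner does not increase the norm. -/
lemma rectNorm_toBlocks₁₂_le {m n : ℕ} (X : Matrix (Fin (m + n)) (Fin (m + n)) E) :
    rectNorm (X.submatrix (Fin.castAdd n) (Fin.natAdd m)) ≤ MatrixNorm.mnorm (m + n) X := by
  -- `P` and `Q` are the coordinate projections onto the first `m` and the last `n` coordinates; `P
  -- X Q` keeps exactly the upper right corner.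
  set P : Matrix (Fin (m + n)) (Fin (m + n)) ℂ :=
    Matrix.diagonal (Fin.addCases (fun _ => 1) (fun _ => 0)) with hP
  set Q : Matrix (Fin (m + n)) (Fin (m + n)) ℂ :=
    Matrix.diagonal (Fin.addCases (fun _ => 0) (fun _ => 1)) with hQ
  have hP1 : ‖P‖ ≤ 1 := by
    rw [hP, Matrix.l2_opNorm_diagonal]
    refine (pi_norm_le_iff_of_nonneg zero_le_one).2 fun i => ?_
    refine Fin.addCases (fun i => ?_) (fun i => ?_) i <;> simp
  have hQ1 : ‖Q‖ ≤ 1 := by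
    rw [hQ, Matrix.l2_opNorm_diagonal]
    refine (pi_norm_le_iff_of_nonneg zero_le_one).2 fun i => ?_
    refine Fin.addCases (fun i => ?_) (fun i => ?_) i <;> simp
  have h : corner (X.submatrix (Fin.castAdd n) (Fin.natAdd m)) = scalarMulMul P X Q := by
    ext i j
    have h1 : scalarMulMul P X Q i j = (P i i * Q j j) • X i j := by
      simp only [scalarMulMul, Matrix.of_apply]
      rw [Finset.sum_eq_single i, Finset.sum_eq_single j]
      · intro b _ hb; simp [hQ, Matrix.diagonal_apply_ne _ hb]
      · simp
      · intro b _ hb; simp [hP, Matrix.diagonal_apply_ne _ hb.symm]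
      · simp
    rw [h1]
    refine Fin.addCases (fun i => ?_) (fun i => ?_) i <;>
      refine Fin.addCases (fun j => ?_) (fun j => ?_) j <;> simp [corner, hP, hQ]
  rw [rectNorm_eq, h]
  exact mnorm_scalarMulMul_le_of_le_one X hP1 hQ1

/-- The padded `2 × 2` matrix is a column selection times `x` times a row selection, both scalar
factors having norm at most one. -/
lemma rectNorm_single_le (x : E) :
    rectNorm (Matrix.of fun (_ : Fin 1) (_ : Fin 1) => x) ≤ ‖x‖ := by
  have hs (k : Fin 2) : Function.Injective (fun _ : Fin 1 => k) :=
    Function.injective_of_subsingleton _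
  have h : corner (Matrix.of fun (_ : Fin 1) (_ : Fin 1) => x) =
      scalarMulMul ((1 : Matrix (Fin 2) (Fin 2) ℂ).submatrix id fun _ : Fin 1 => 0)
        (Matrix.of fun (_ : Fin 1) (_ : Fin 1) => x)
        ((1 : Matrix (Fin 2) (Fin 2) ℂ).submatrix (fun _ : Fin 1 => 1) id) := by
    have e0 : finSumFinEquiv.symm (0 : Fin (1 + 1)) = Sum.inl 0 := rfl
    have e1 : finSumFinEquiv.symm (1 : Fin (1 + 1)) = Sum.inr 0 := rfl
    ext i j
    refine Fin.addCases (fun i => ?_) (fun i => ?_) i <;>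
      refine Fin.addCases (fun j => ?_) (fun j => ?_) j <;>
      obtain rfl := Subsingleton.elim i 0 <;> obtain rfl := Subsingleton.elim j 0 <;>
      simp [corner, scalarMulMul, e0, e1]
    exact (by rw [Matrix.one_apply_eq, Matrix.one_apply_eq, mul_one, one_smul] :
      x = ((1 : Matrix (Fin 2) (Fin 2) ℂ) 0 0 * (1 : Matrix (Fin 2) (Fin 2) ℂ) 1 1) • x)
  rw [rectNorm_eq, h, ← OperatorSpace.mnorm_one x]
  exact mnorm_scalarMulMul_le_of_le_one _ (norm_one_submatrix_le' (hs 0))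
    (norm_one_submatrix_le (hs 1))

end MatrixBounds

section CompletelyBounded

variable {E F : Type*} [NormedAddCommGroup E] [NormedSpace ℂ E] [OperatorSpace E]
  [NormedAddCommGroup F] [NormedSpace ℂ F] [OperatorSpace F]

/-- The constant in the definition may be negative when `E` is zero; multiplying estimates requires
a positive one. -/
lemma IsCompletelyBounded.exists_pos {f : E →ₗ[ℂ] F} (hf : IsCompletelyBounded f) :
    ∃ C : ℝ, 0 < C ∧ ∀ (n : ℕ) (x : Matrix (Fin n) (Fin n) E),
      MatrixNorm.mnorm n (x.map f) ≤ C * MatrixNorm.mnorm n x := by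
  obtain ⟨C, hC⟩ := hf
  refine ⟨|C| + 1, by positivity, fun n x => (hC n x).trans ?_⟩
  exact mul_le_mul_of_nonneg_right (by linarith [le_abs_self C]) (mnorm_nonneg n x)

lemma IsCompletelyBounded.norm_le {f : E →ₗ[ℂ] F} {C : ℝ}
    (hC : ∀ (n : ℕ) (x : Matrix (Fin n) (Fin n) E),
      MatrixNorm.mnorm n (x.map f) ≤ C * MatrixNorm.mnorm n x) (x : E) : ‖f x‖ ≤ C * ‖x‖ := by
  have := hC 1 (Matrix.of fun _ _ => x)
  rw [OperatorSpace.mnorm_one] at this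
  exact (OperatorSpace.mnorm_one (f x)).symm.le.trans this

lemma IsCompletelyBounded.continuous {f : E →ₗ[ℂ] F} (hf : IsCompletelyBounded f) :
    Continuous f := by
  obtain ⟨C, hC⟩ := hf
  exact AddMonoidHomClass.continuous_of_bound f C (IsCompletelyBounded.norm_le hC)

end CompletelyBounded
end OpMod

namespace OpMod

/-! ### Subspaces, quotients and products of operator spaces. -/

section Subspace

variable {E : Type*} [NormedAddCommGroup E] [NormedSpace ℂ E] [OperatorSpace E]

/-- A closed subspace of an operator space is an operator space. -/
instance (K : Submodule ℂ E) [hK : IsClosed (K : Set E)] : OperatorSpace K where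
  mnorm n x := MatrixNorm.mnorm n (x.map K.subtype)
  toCompleteSpace := hK.completeSpace_coe
  mnorm_add_le n x y := by
    rw [Matrix.map_add _ (map_add _)]
    exact OperatorSpace.mnorm_add_le n _ _
  mnorm_smul n c x := by
    rw [Matrix.map_smul _ _ (map_smul _ c)]
    exact OperatorSpace.mnorm_smul n _ _
  eq_zero_of_mnorm n x h := by
    have := OperatorSpace.eq_zero_of_mnorm n _ h
    ext i j
    exact congrFun (congrFun this i) j
  mnorm_one x := OperatorSpace.mnorm_one (x : E)
  mnorm_directSum m n x y := by
    rw [map_directSum, OperatorSpace.mnorm_directSum]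
  mnorm_scalarMulMul_le n m α x β := by
    rw [map_scalarMulMul]
    exact OperatorSpace.mnorm_scalarMulMul_le n m _ _ _

lemma mnorm_subspace (K : Submodule ℂ E) [IsClosed (K : Set E)] {n : ℕ}
    (x : Matrix (Fin n) (Fin n) K) :
    MatrixNorm.mnorm n x = MatrixNorm.mnorm n (x.map K.subtype) := rfl

lemma subtype_mem_CB (K : Submodule ℂ E) [IsClosed (K : Set E)] : K.subtype ∈ CB K E :=
  ⟨1, fun n x => by rw [one_mul, mnorm_subspace]⟩

lemma codRestrict_mem_CB {F : Type*} [NormedAddCommGroup F] [NormedSpace ℂ F] [OperatorSpace F]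
    (K : Submodule ℂ E) [IsClosed (K : Set E)] {f : F →ₗ[ℂ] E} (hf : f ∈ CB F E)
    (h : ∀ x, f x ∈ K) : f.codRestrict K h ∈ CB F K := hf

end Subspace

section Quotient

variable {E : Type*} [NormedAddCommGroup E] [NormedSpace ℂ E] [OperatorSpace E]

/-- The quotient matrix norm, `M_n(E / K) = M_n(E) / M_n(K)`. -/
noncomputable instance (K : Submodule ℂ E) : MatrixNorm (E ⧸ K) where
  mnorm n x := ⨅ y : {y : Matrix (Fin n) (Fin n) E // y.map K.mkQ = x}, MatrixNorm.mnorm n y.1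

variable (K : Submodule ℂ E) {n : ℕ}

instance (x : Matrix (Fin n) (Fin n) (E ⧸ K)) :
    Nonempty {y : Matrix (Fin n) (Fin n) E // y.map K.mkQ = x} := by
  choose g hg using K.mkQ_surjective
  exact ⟨x.map g, by ext i j; exact hg _⟩

lemma mnorm_map_mkQ_le (y : Matrix (Fin n) (Fin n) E) :
    MatrixNorm.mnorm n (y.map K.mkQ) ≤ MatrixNorm.mnorm n y :=
  ciInf_le (f := fun z : {z : Matrix (Fin n) (Fin n) E // z.map K.mkQ = y.map K.mkQ} =>
    MatrixNorm.mnorm n z.1) ⟨0, by rintro _ ⟨z, rfl⟩; exact mnorm_nonneg n z.1⟩ ⟨y, rfl⟩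

lemma mnorm_quotient_nonneg (x : Matrix (Fin n) (Fin n) (E ⧸ K)) : 0 ≤ MatrixNorm.mnorm n x :=
  le_ciInf fun y => mnorm_nonneg n y.1

lemma exists_lift_mnorm_lt (x : Matrix (Fin n) (Fin n) (E ⧸ K)) {ε : ℝ} (hε : 0 < ε) :
    ∃ y : Matrix (Fin n) (Fin n) E, y.map K.mkQ = x ∧
      MatrixNorm.mnorm n y < MatrixNorm.mnorm n x + ε := by
  obtain ⟨y, hy⟩ := exists_lt_of_ciInf_lt (lt_add_of_pos_right (MatrixNorm.mnorm n x) hε)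
  exact ⟨y.1, y.2, hy⟩

/-- A bound valid for every lift passes to the infimum; estimates on maps out of a quotient are
thereby checked in `E`. -/
lemma le_mul_mnorm_quotient {x : Matrix (Fin n) (Fin n) (E ⧸ K)} {a c : ℝ} (ha : 0 ≤ a)
    (h : ∀ y : Matrix (Fin n) (Fin n) E, y.map K.mkQ = x → c ≤ a * MatrixNorm.mnorm n y) :
    c ≤ a * MatrixNorm.mnorm n x := by
  refine le_of_forall_pos_le_add fun ε hε => ?_
  -- Dividing by `a + 1` instead of `a` covers `a = 0`.
  obtain ⟨y, hy, hy'⟩ := exists_lift_mnorm_lt K x (ε := ε / (a + 1)) (by positivity)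
  calc c ≤ a * MatrixNorm.mnorm n y := h y hy
    _ ≤ a * (MatrixNorm.mnorm n x + ε / (a + 1)) := by gcongr
    _ = a * MatrixNorm.mnorm n x + a / (a + 1) * ε := by ring
    _ ≤ a * MatrixNorm.mnorm n x + 1 * ε := by
        gcongr
        rw [div_le_one (by positivity)]
        linarith
    _ = a * MatrixNorm.mnorm n x + ε := by ring

lemma le_mnorm_quotient {x : Matrix (Fin n) (Fin n) (E ⧸ K)} {c : ℝ}
    (h : ∀ y : Matrix (Fin n) (Fin n) E, y.map K.mkQ = x → c ≤ MatrixNorm.mnorm n y) :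
    c ≤ MatrixNorm.mnorm n x :=
  le_ciInf fun y => h y.1 y.2

/-- Holds for each lift, hence for the infimum. It compares the matrix norm with the Banach quotient
norm and yields definiteness and half of `mnorm_one`. -/
lemma norm_apply_le_mnorm_quotient (x : Matrix (Fin n) (Fin n) (E ⧸ K)) (i j : Fin n) :
    ‖x i j‖ ≤ MatrixNorm.mnorm n x := by
  refine le_mnorm_quotient K fun y hy => ?_
  subst hy
  exact (Submodule.Quotient.norm_mk_le K (y i j)).trans (norm_apply_le_mnorm y i j)

lemma mnorm_quotient_smul_le (c : ℂ) (x : Matrix (Fin n) (Fin n) (E ⧸ K)) :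
    MatrixNorm.mnorm n (c • x) ≤ ‖c‖ * MatrixNorm.mnorm n x := by
  refine le_mul_mnorm_quotient K (norm_nonneg c) fun y hy => ?_
  rw [← hy, ← OperatorSpace.mnorm_smul, ← Matrix.map_smul _ _ (map_smul K.mkQ c)]
  exact mnorm_map_mkQ_le K _

open scoped Matrix.Norms.L2Operator in
/-- The quotient of an operator space by a closed subspace is an operator space. -/
noncomputable instance [hK : IsClosed (K : Set E)] : OperatorSpace (E ⧸ K) where
  toCompleteSpace := inferInstance
  mnorm_add_le n x y := by
    refine le_of_forall_pos_le_add fun ε hε => ?_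
    obtain ⟨x', rfl, hx⟩ := exists_lift_mnorm_lt K x (half_pos hε)
    obtain ⟨y', rfl, hy⟩ := exists_lift_mnorm_lt K y (half_pos hε)
    rw [← Matrix.map_add _ (map_add K.mkQ)]
    have h1 := mnorm_map_mkQ_le K (x' + y')
    have h2 := OperatorSpace.mnorm_add_le n x' y'
    linarith
  mnorm_smul n c x := by
    refine le_antisymm (mnorm_quotient_smul_le K c x) ?_
    rcases eq_or_ne c 0 with rfl | hc
    · simpa using mnorm_quotient_nonneg K _
    -- The reverse inequality is the first one for `c⁻¹`, applied to `c • x`.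
    · have h := mnorm_quotient_smul_le K c⁻¹ (c • x)
      rw [inv_smul_smul₀ hc, norm_inv] at h
      rwa [← le_inv_mul_iff₀ (norm_pos_iff.2 hc)]
  eq_zero_of_mnorm n x h := by
    ext i j
    exact norm_le_zero_iff.1 (h ▸ norm_apply_le_mnorm_quotient K x i j)
  mnorm_one x := by
    refine le_antisymm (le_of_forall_pos_le_add fun ε hε => ?_)
      (norm_apply_le_mnorm_quotient K (Matrix.of fun (_ _ : Fin 1) => x) 0 0)
    obtain ⟨m, rfl, hm⟩ := Submodule.Quotient.norm_mk_lt x hε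
    refine le_trans ?_ hm.le
    rw [← OperatorSpace.mnorm_one m]
    exact mnorm_map_mkQ_le K (Matrix.of fun _ _ => m)
  mnorm_directSum m n x y := by
    refine le_antisymm (le_of_forall_pos_le_add fun ε hε => ?_) (max_le ?_ ?_)
    · obtain ⟨x', rfl, hx⟩ := exists_lift_mnorm_lt K x hε
      obtain ⟨y', rfl, hy⟩ := exists_lift_mnorm_lt K y hε
      rw [← map_directSum, ← max_add_add_right]
      refine (mnorm_map_mkQ_le K _).trans ?_
      rw [OperatorSpace.mnorm_directSum]
      exact max_le_max hx.le hy.le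
    -- A lift `z` need not be block diagonal, but its diagonal blocks lift `x` and `y` and have no
    -- larger norm.
    · refine le_mnorm_quotient K fun z hz => ?_
      have hx : x = (z.submatrix (Fin.castAdd n) (Fin.castAdd n)).map K.mkQ := by
        rw [← Matrix.submatrix_map, hz]
        ext i j
        simp [directSum]
      rw [hx]
      exact (mnorm_map_mkQ_le K _).trans
        (mnorm_submatrix_le z (Fin.castAdd_injective m n) (Fin.castAdd_injective m n))
    · refine le_mnorm_quotient K fun z hz => ?_
      have hy : y = (z.submatrix (Fin.natAdd m) (Fin.natAdd m)).map K.mkQ := by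
        rw [← Matrix.submatrix_map, hz]
        ext i j
        simp [directSum]
      rw [hy]
      exact (mnorm_map_mkQ_le K _).trans
        (mnorm_submatrix_le z (Fin.natAdd_injective n m) (Fin.natAdd_injective n m))
  mnorm_scalarMulMul_le n m α x β := by
    rw [mul_right_comm]
    refine le_mul_mnorm_quotient K (by positivity) fun y hy => ?_
    rw [← hy, ← map_scalarMulMul, mul_right_comm]
    exact (mnorm_map_mkQ_le K _).trans (OperatorSpace.mnorm_scalarMulMul_le n m α y β)

lemma mkQ_mem_CB [IsClosed (K : Set E)] : K.mkQ ∈ CB E (E ⧸ K) :=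
  ⟨1, fun n y => by rw [one_mul]; exact mnorm_map_mkQ_le K y⟩

lemma liftQ_mem_CB [IsClosed (K : Set E)] {F : Type*} [NormedAddCommGroup F] [NormedSpace ℂ F]
    [OperatorSpace F] {f : E →ₗ[ℂ] F} (hf : f ∈ CB E F) (h : K ≤ LinearMap.ker f) :
    K.liftQ f h ∈ CB (E ⧸ K) F := by
  obtain ⟨C, hC0, hC⟩ := IsCompletelyBounded.exists_pos hf
  refine ⟨C, fun n x => le_mul_mnorm_quotient K hC0.le fun y hy => ?_⟩
  subst hy
  exact hC n y

end Quotient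

section Prod

variable {E F : Type*} [NormedAddCommGroup E] [NormedSpace ℂ E] [OperatorSpace E]
  [NormedAddCommGroup F] [NormedSpace ℂ F] [OperatorSpace F]

open scoped Matrix.Norms.L2Operator in
/-- The product of two operator spaces, with the maximum matrix norms. -/
noncomputable instance : OperatorSpace (E × F) where
  mnorm n x := max (MatrixNorm.mnorm n (x.map (LinearMap.fst ℂ E F)))
    (MatrixNorm.mnorm n (x.map (LinearMap.snd ℂ E F)))
  toCompleteSpace := inferInstance
  mnorm_add_le n x y := by
    rw [Matrix.map_add _ (map_add _), Matrix.map_add _ (map_add _)]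
    exact (max_le_max (OperatorSpace.mnorm_add_le n _ _) (OperatorSpace.mnorm_add_le n _ _)).trans
      max_add_add_le_max_add_max
  mnorm_smul n c x := by
    rw [Matrix.map_smul _ _ (map_smul _ c), Matrix.map_smul _ _ (map_smul _ c),
      OperatorSpace.mnorm_smul, OperatorSpace.mnorm_smul, mul_max_of_nonneg _ _ (norm_nonneg c)]
  eq_zero_of_mnorm n x h := by
    have h1 := OperatorSpace.eq_zero_of_mnorm n _
      (le_antisymm ((le_max_left _ _).trans h.le) (mnorm_nonneg n _))
    have h2 := OperatorSpace.eq_zero_of_mnorm n _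
      (le_antisymm ((le_max_right _ _).trans h.le) (mnorm_nonneg n _))
    ext i j
    · exact congrFun (congrFun h1 i) j
    · exact congrFun (congrFun h2 i) j
  mnorm_one x := congrArg₂ max (OperatorSpace.mnorm_one x.1) (OperatorSpace.mnorm_one x.2)
  mnorm_directSum m n x y := by
    rw [map_directSum, map_directSum, OperatorSpace.mnorm_directSum,
      OperatorSpace.mnorm_directSum, max_max_max_comm]
  mnorm_scalarMulMul_le n m α x β := by
    rw [map_scalarMulMul, map_scalarMulMul, mul_max_of_nonneg _ _ (norm_nonneg α),
      max_mul_of_nonneg _ _ (norm_nonneg β)]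
    exact max_le_max (OperatorSpace.mnorm_scalarMulMul_le n m _ _ _)
      (OperatorSpace.mnorm_scalarMulMul_le n m _ _ _)

lemma mnorm_prod {n : ℕ} (x : Matrix (Fin n) (Fin n) (E × F)) :
    MatrixNorm.mnorm n x = max (MatrixNorm.mnorm n (x.map (LinearMap.fst ℂ E F)))
      (MatrixNorm.mnorm n (x.map (LinearMap.snd ℂ E F))) := rfl

lemma fst_mem_CB : LinearMap.fst ℂ E F ∈ CB (E × F) E :=
  ⟨1, fun n x => by rw [one_mul]; exact le_max_left _ _⟩

lemma snd_mem_CB : LinearMap.snd ℂ E F ∈ CB (E × F) F :=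
  ⟨1, fun n x => by rw [one_mul]; exact le_max_right _ _⟩

lemma prod_mem_CB {G : Type*} [NormedAddCommGroup G] [NormedSpace ℂ G] [OperatorSpace G]
    {f : G →ₗ[ℂ] E} {g : G →ₗ[ℂ] F} (hf : f ∈ CB G E) (hg : g ∈ CB G F) :
    f.prod g ∈ CB G (E × F) := by
  obtain ⟨C, hC⟩ := hf
  obtain ⟨D, hD⟩ := hg
  refine ⟨max C D, fun n x => max_le ((hC n x).trans ?_) ((hD n x).trans ?_)⟩
  · exact mul_le_mul_of_nonneg_right (le_max_left _ _) (mnorm_nonneg n x)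
  · exact mul_le_mul_of_nonneg_right (le_max_right _ _) (mnorm_nonneg n x)

lemma inl_mem_CB : LinearMap.inl ℂ E F ∈ CB E (E × F) :=
  prod_mem_CB (id_mem_CB E) (CB E F).zero_mem

lemma inr_mem_CB : LinearMap.inr ℂ E F ∈ CB F (E × F) :=
  prod_mem_CB (CB F E).zero_mem (id_mem_CB F)

end Prod

/-- The zero operator space. -/
instance : OperatorSpace PUnit.{u + 1} where
  mnorm _ _ := 0
  toCompleteSpace := inferInstance
  mnorm_add_le _ _ _ := by simp
  mnorm_smul _ _ _ := by simp
  eq_zero_of_mnorm _ _ _ := Subsingleton.elim _ _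
  mnorm_one _ := by simp
  mnorm_directSum _ _ _ _ := by simp
  mnorm_scalarMulMul_le _ _ _ _ _ := by simp

end OpMod

namespace OpMod

open CategoryTheory CategoryTheory.Limits

/-! ### Kernel–cokernel pairs in preadditive categories. -/

section KernelCokernelPairs

variable {C : Type*} [Category* C] [Preadditive C]

lemma IsKernelCokernelPair.mono_f {S : ShortComplex C} (h : IsKernelCokernelPair S) : Mono S.f :=
  Fork.IsLimit.mono h.1.some

lemma IsKernelCokernelPair.epi_g {S : ShortComplex C} (h : IsKernelCokernelPair S) : Epi S.g :=
  Cofork.IsColimit.epi h.2.some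

lemma IsKernelCokernelPair.exists_lift {S : ShortComplex C} (h : IsKernelCokernelPair S) {W : C}
    (k : W ⟶ S.X₂) (hk : k ≫ S.g = 0) : ∃ l : W ⟶ S.X₁, l ≫ S.f = k := by
  obtain ⟨l, hl⟩ := KernelFork.IsLimit.lift' h.1.some k hk
  exact ⟨l, hl⟩

lemma IsKernelCokernelPair.exists_desc {S : ShortComplex C} (h : IsKernelCokernelPair S) {W : C}
    (k : S.X₂ ⟶ W) (hk : S.f ≫ k = 0) : ∃ l : S.X₃ ⟶ W, S.g ≫ l = k := by
  obtain ⟨l, hl⟩ := CokernelCofork.IsColimit.desc' h.2.some k hk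
  exact ⟨l, hl⟩

/-- Uniqueness of factorisations comes from `Mono` and `Epi`, so only existence is left to check. -/
lemma IsKernelCokernelPair.mk' {S : ShortComplex C} [hf : Mono S.f] [hg : Epi S.g]
    (hl : ∀ {W : C} (k : W ⟶ S.X₂), k ≫ S.g = 0 → ∃ l : W ⟶ S.X₁, l ≫ S.f = k)
    (hd : ∀ {W : C} (k : S.X₂ ⟶ W), S.f ≫ k = 0 → ∃ l : S.X₃ ⟶ W, S.g ≫ l = k) :
    IsKernelCokernelPair S :=
  ⟨⟨KernelFork.IsLimit.ofι' _ _ fun k hk => ⟨(hl k hk).choose, (hl k hk).choose_spec⟩⟩,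
    ⟨CokernelCofork.IsColimit.ofπ' _ _ fun k hk => ⟨(hd k hk).choose, (hd k hk).choose_spec⟩⟩⟩

/-- A pair isomorphic to a kernel-cokernel pair is a kernel-cokernel pair. -/
lemma IsKernelCokernelPair.of_iso {S T : ShortComplex C} (e : S ≅ T)
    (h : IsKernelCokernelPair S) : IsKernelCokernelPair T := by
  have := h.mono_f
  have := h.epi_g
  have hf : T.f = e.inv.τ₁ ≫ S.f ≫ e.hom.τ₂ := by
    rw [← e.hom.comm₁₂, ← Category.assoc, ← ShortComplex.comp_τ₁]; simp
  have hg : T.g = e.inv.τ₂ ≫ S.g ≫ e.hom.τ₃ := by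
    rw [← e.hom.comm₂₃, ← Category.assoc, ← ShortComplex.comp_τ₂]; simp
  have : Mono T.f := hf ▸ inferInstance
  have : Epi T.g := hg ▸ inferInstance
  refine .mk' (fun k hk => ?_) fun k hk => ?_
  · obtain ⟨l, hl⟩ := h.exists_lift (k ≫ e.inv.τ₂)
      (by rw [Category.assoc, e.inv.comm₂₃, reassoc_of% hk, zero_comp])
    refine ⟨l ≫ e.hom.τ₁, ?_⟩
    rw [Category.assoc, e.hom.comm₁₂, reassoc_of% hl, ← ShortComplex.comp_τ₂]
    simp
  · obtain ⟨l, hl⟩ := h.exists_desc (e.hom.τ₂ ≫ k)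
      (by rw [← e.hom.comm₁₂_assoc, hk, comp_zero])
    refine ⟨e.inv.τ₃ ≫ l, ?_⟩
    rw [← e.inv.comm₂₃_assoc, hl, ← Category.assoc, ← ShortComplex.comp_τ₂]
    simp

/-- A pair is determined by its first component up to isomorphism. -/
lemma ShortComplex.nonempty_iso_of_cokernels {X Y Z Z' : C} {f : X ⟶ Y} {g : Y ⟶ Z} {g' : Y ⟶ Z'}
    (w : f ≫ g = 0) (w' : f ≫ g' = 0) (h : IsColimit (CokernelCofork.ofπ g w))
    (h' : IsColimit (CokernelCofork.ofπ g' w')) :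
    Nonempty (ShortComplex.mk f g w ≅ ShortComplex.mk f g' w') := by
  refine ⟨ShortComplex.isoMk (Iso.refl _) (Iso.refl _) (h.coconePointUniqueUpToIso h') ?_ ?_⟩
  · simp
  · simpa using (h.comp_coconePointUniqueUpToIso_hom h' .one).symm

/-- A pair is determined by its second component up to isomorphism. -/
lemma ShortComplex.nonempty_iso_of_kernels {X X' Y Z : C} {f : X ⟶ Y} {f' : X' ⟶ Y} {g : Y ⟶ Z}
    (w : f ≫ g = 0) (w' : f' ≫ g = 0) (h : IsLimit (KernelFork.ofι f w))
    (h' : IsLimit (KernelFork.ofι f' w')) :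
    Nonempty (ShortComplex.mk f g w ≅ ShortComplex.mk f' g w') := by
  refine ⟨ShortComplex.isoMk (h.conePointUniqueUpToIso h') (Iso.refl _) (Iso.refl _) ?_ ?_⟩
  · simpa using h.conePointUniqueUpToIso_hom_comp h' .zero
  · simp

end KernelCokernelPairs

/-! ### The split exact structure. -/

section Split

variable {C : Type*} [Category* C] [Preadditive C]

lemma Emin_of_splitting [HasZeroObject C] {S : ShortComplex C} (s : S.Splitting) : Emin C S :=
  ⟨⟨⟨s.fIsKernel⟩, ⟨s.gIsCokernel⟩⟩, ⟨s⟩⟩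

variable [HasZeroObject C]

/-- With a retraction `r` of `f`, the idempotent `𝟙 - r ≫ f` kills `f`, so it descends to the
cokernel and gives the section. -/
lemma admissibleMono_Emin_iff [HasCokernels C] {X Y : C} (f : X ⟶ Y) :
    AdmissibleMono (Emin C) f ↔ IsSplitMono f := by
  refine ⟨fun ⟨_, _, _, h⟩ => h.2.some.isSplitMono_f, fun h => ?_⟩
  refine ⟨_, cokernel.π f, cokernel.condition f, Emin_of_splitting
    { r := retraction f
      s := cokernel.desc f (𝟙 _ - retraction f ≫ f) (by simp)
      f_r := by simp
      s_g := ?_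
      id := by simp }⟩
  dsimp
  ext
  simp

lemma admissibleEpi_Emin_iff [HasKernels C] {X Y : C} (f : X ⟶ Y) :
    AdmissibleEpi (Emin C) f ↔ IsSplitEpi f := by
  refine ⟨fun ⟨_, _, _, h⟩ => h.2.some.isSplitEpi_g, fun h => ?_⟩
  refine ⟨_, kernel.ι f, kernel.condition f, Emin_of_splitting
    { s := section_ f
      r := kernel.lift f (𝟙 _ - f ≫ section_ f) (by simp)
      s_g := by simp
      f_r := ?_
      id := by simp }⟩
  dsimp
  ext
  simp

end Split

section Split

variable (C : Type*) [Category* C] [Preadditive C] [HasBinaryProducts C]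

lemma hasPullbacks_of_hasKernels [HasKernels C] : HasPullbacks C :=
  have := Preadditive.hasEqualizers_of_hasKernels (C := C)
  hasPullbacks_of_hasBinaryProducts_of_hasEqualizers C

lemma hasPushouts_of_hasCokernels [HasCokernels C] : HasPushouts C :=
  have := Preadditive.hasCoequalizers_of_hasCokernels (C := C)
  have := HasBinaryBiproducts.of_hasBinaryProducts (C := C)
  hasPushouts_of_hasBinaryCoproducts_of_hasCoequalizers C

/-- The split kernel-cokernel pairs form an exact structure. -/
theorem isExactCategory_Emin [HasZeroObject C] [HasKernels C] [HasCokernels C] :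
    IsExactCategory (Emin C) where
  hasZeroObject := inferInstance
  hasBinaryProducts := inferInstance
  isExactStructure :=
    { isKernelCokernelPair := fun _ h => h.1
      of_iso := fun _ _ ⟨e⟩ h => ⟨h.1.of_iso e, ⟨h.2.some.ofIso e⟩⟩
      id_mono := fun _ => (admissibleMono_Emin_iff _).2 inferInstance
      id_epi := fun _ => (admissibleEpi_Emin_iff _).2 inferInstance
      comp_mono := fun f g hf hg => by
        rw [admissibleMono_Emin_iff] at *
        infer_instance
      comp_epi := fun f g hf hg => by
        rw [admissibleEpi_Emin_iff] at *
        infer_instance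
      pushout := fun f g hf => by
        have := hasPushouts_of_hasCokernels C
        refine ⟨inferInstance, fun inl inr h => ?_⟩
        rw [admissibleMono_Emin_iff] at *
        -- `f ≫ retraction f ≫ g = g = g ≫ 𝟙`, so the pushout property produces a retraction of
        -- `inr`.
        exact ⟨⟨⟨h.desc (retraction f ≫ g) (𝟙 _) (by simp), by simp⟩⟩⟩
      pullback := fun f g hf => by
        have := hasPullbacks_of_hasKernels C
        refine ⟨inferInstance, fun fst snd h => ?_⟩
        rw [admissibleEpi_Emin_iff] at *
        exact ⟨⟨⟨h.lift (g ≫ section_ f) (𝟙 _) (by simp), by simp⟩⟩⟩ }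

end Split

/-! ### Pulling exact structures back along a functor. -/

section Comap

variable {C D : Type*} [Category* C] [Preadditive C] [Category* D] [Preadditive D]
  (U : C ⥤ D) [U.Additive]

/-- Since kernels and cokernels exist and are preserved, reflecting isomorphisms makes `U` reflect
them as well. -/
lemma isKernelCokernelPair_map_iff [U.ReflectsIsomorphisms] [HasKernels C] [HasCokernels C]
    [∀ {X Y : C} (f : X ⟶ Y), PreservesLimit (parallelPair f 0) U]
    [∀ {X Y : C} (f : X ⟶ Y), PreservesColimit (parallelPair f 0) U] (S : ShortComplex C) :
    IsKernelCokernelPair (S.map U) ↔ IsKernelCokernelPair S := by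
  have := reflectsLimit_of_reflectsIsomorphisms (parallelPair S.g 0) U
  have := reflectsColimit_of_reflectsIsomorphisms (parallelPair S.f 0) U
  constructor
  · rintro ⟨⟨hk⟩, ⟨hc⟩⟩
    exact ⟨⟨isLimitOfReflects U
        ((KernelFork.isLimitMapConeEquiv (KernelFork.ofι S.f S.zero) U).symm hk)⟩,
      ⟨isColimitOfReflects U
        ((CokernelCofork.isColimitMapCoconeEquiv (CokernelCofork.ofπ S.g S.zero) U).symm hc)⟩⟩
  · rintro ⟨⟨hk⟩, ⟨hc⟩⟩
    exact ⟨⟨KernelFork.mapIsLimit _ hk U⟩, ⟨CokernelCofork.mapIsColimit _ hc U⟩⟩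

variable {E : ObjectProperty (ShortComplex D)}

/-- The image of `cokernel.π f` is a cokernel of `U.map f`, so it agrees up to isomorphism with
whichever second component witnesses admissibility in `D`. -/
lemma admissibleMono_comap_iff (hE : IsExactStructure E) [HasCokernels C]
    [∀ {X Y : C} (f : X ⟶ Y), PreservesColimit (parallelPair f 0) U] {X Y : C} (f : X ⟶ Y) :
    AdmissibleMono (fun S => E (S.map U)) f ↔ AdmissibleMono E (U.map f) := by
  refine ⟨fun ⟨Z, π, w, h⟩ => ⟨_, U.map π, ((ShortComplex.mk f π w).map U).zero, h⟩,
    fun ⟨Z, π, w, h⟩ => ?_⟩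
  refine ⟨_, cokernel.π f, cokernel.condition f, hE.of_iso _ _ ?_ h⟩
  exact ShortComplex.nonempty_iso_of_cokernels w _ (hE.isKernelCokernelPair _ h).2.some
    (CokernelCofork.mapIsColimit _ (cokernelIsCokernel f) U)

lemma admissibleEpi_comap_iff (hE : IsExactStructure E) [HasKernels C]
    [∀ {X Y : C} (f : X ⟶ Y), PreservesLimit (parallelPair f 0) U] {X Y : C} (f : X ⟶ Y) :
    AdmissibleEpi (fun S => E (S.map U)) f ↔ AdmissibleEpi E (U.map f) := by
  refine ⟨fun ⟨Z, μ, w, h⟩ => ⟨_, U.map μ, ((ShortComplex.mk μ f w).map U).zero, h⟩,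
    fun ⟨Z, μ, w, h⟩ => ?_⟩
  refine ⟨_, kernel.ι f, kernel.condition f, hE.of_iso _ _ ?_ h⟩
  exact ShortComplex.nonempty_iso_of_kernels w _ (hE.isKernelCokernelPair _ h).1.some
    (KernelFork.mapIsLimit _ (kernelIsKernel f) U)

/-- Exact structures pull back along functors that preserve kernels and cokernels and reflect
isomorphisms. -/
theorem isExactCategory_comap (hE : IsExactStructure E) [U.ReflectsIsomorphisms]
    [HasZeroObject C] [HasBinaryProducts C] [HasKernels C] [HasCokernels C] [HasZeroObject D]
    [∀ {X Y : C} (f : X ⟶ Y), PreservesLimit (parallelPair f 0) U]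
    [∀ {X Y : C} (f : X ⟶ Y), PreservesColimit (parallelPair f 0) U] :
    IsExactCategory fun S : ShortComplex C => E (S.map U) where
  hasZeroObject := inferInstance
  hasBinaryProducts := inferInstance
  isExactStructure :=
    { isKernelCokernelPair := fun S h =>
        (isKernelCokernelPair_map_iff U S).1 (hE.isKernelCokernelPair _ h)
      of_iso := fun _ _ ⟨e⟩ h => hE.of_iso _ _ ⟨U.mapShortComplex.mapIso e⟩ h
      id_mono := fun X => by
        rw [admissibleMono_comap_iff U hE, U.map_id]
        exact hE.id_mono _
      id_epi := fun X => by
        rw [admissibleEpi_comap_iff U hE, U.map_id]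
        exact hE.id_epi _
      comp_mono := fun f g hf hg => by
        rw [admissibleMono_comap_iff U hE] at *
        rw [U.map_comp]
        exact hE.comp_mono _ _ hf hg
      comp_epi := fun f g hf hg => by
        rw [admissibleEpi_comap_iff U hE] at *
        rw [U.map_comp]
        exact hE.comp_epi _ _ hf hg
      pushout := fun f g hf => by
        have := hasPushouts_of_hasCokernels C
        have := Preadditive.hasCoequalizers_of_hasCokernels (C := C)
        have := HasBinaryBiproducts.of_hasBinaryProducts (C := C)
        have := hasFiniteCoproducts_of_has_binary_and_initial (C := C)
        -- Additivity and preservation of cokernels give all finite colimits, so the pushout square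
        -- maps to a pushout square in `D`.
        have := Functor.preservesFiniteColimits_of_preservesCokernels U
        refine ⟨inferInstance, fun inl inr h => ?_⟩
        rw [admissibleMono_comap_iff U hE] at *
        exact (hE.pushout _ (U.map g) hf).2 _ _ (h.map U)
      pullback := fun f g hf => by
        have := hasPullbacks_of_hasKernels C
        have := Preadditive.hasEqualizers_of_hasKernels (C := C)
        have := HasBinaryBiproducts.of_hasBinaryProducts (C := C)
        have := hasFiniteProducts_of_has_binary_and_terminal (C := C)
        have := Functor.preservesFiniteLimits_of_preservesKernels U
        refine ⟨inferInstance, fun fst snd h => ?_⟩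
        rw [admissibleEpi_comap_iff U hE] at *
        exact (hE.pullback _ (U.map g) hf).2 _ _ (h.map U) }

end Comap

end OpMod

namespace OpMod

/-! ### Maps completely bounded below and completely open maps. -/

section CompleteBounds

lemma map_linearMap_comp {E F G : Type*} [AddCommGroup E] [Module ℂ E] [AddCommGroup F]
    [Module ℂ F] [AddCommGroup G] [Module ℂ G] {n : ℕ} (x : Matrix (Fin n) (Fin n) E)
    (f : E →ₗ[ℂ] F) (g : F →ₗ[ℂ] G) : x.map (g ∘ₗ f) = (x.map f).map g := rfl

variable {E F G : Type*} [NormedAddCommGroup E] [NormedSpace ℂ E] [OperatorSpace E]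
  [NormedAddCommGroup F] [NormedSpace ℂ F] [OperatorSpace F]
  [NormedAddCommGroup G] [NormedSpace ℂ G] [OperatorSpace G]

lemma isClosed_ker_of_mem_CB {f : E →ₗ[ℂ] F} (hf : f ∈ CB E F) :
    IsClosed (LinearMap.ker f : Set E) :=
  isClosed_singleton.preimage (IsCompletelyBounded.continuous hf)

/-- A linear map is completely bounded below if its amplifications are uniformly bounded below. -/
def IsCompletelyBoundedBelow (f : E →ₗ[ℂ] F) : Prop :=
  ∃ C : ℝ, 0 < C ∧ ∀ (n : ℕ) (x : Matrix (Fin n) (Fin n) E),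
    MatrixNorm.mnorm n x ≤ C * MatrixNorm.mnorm n (x.map f)

/-- A linear map is completely open if its amplifications are uniformly open surjections. -/
def IsCompletelyOpen (f : E →ₗ[ℂ] F) : Prop :=
  ∃ C : ℝ, 0 < C ∧ ∀ (n : ℕ) (y : Matrix (Fin n) (Fin n) F),
    ∃ x : Matrix (Fin n) (Fin n) E, x.map f = y ∧ MatrixNorm.mnorm n x ≤ C * MatrixNorm.mnorm n y

namespace IsCompletelyBoundedBelow

lemma norm_le {f : E →ₗ[ℂ] F} {C : ℝ}
    (hC : ∀ (n : ℕ) (x : Matrix (Fin n) (Fin n) E),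
      MatrixNorm.mnorm n x ≤ C * MatrixNorm.mnorm n (x.map f)) (x : E) : ‖x‖ ≤ C * ‖f x‖ := by
  have := hC 1 (Matrix.of fun _ _ => x)
  rw [OperatorSpace.mnorm_one] at this
  rwa [← OperatorSpace.mnorm_one (f x)]

lemma injective {f : E →ₗ[ℂ] F} (hf : IsCompletelyBoundedBelow f) : Function.Injective f := by
  obtain ⟨C, _, hC⟩ := hf
  refine (injective_iff_map_eq_zero f).2 fun x hx => ?_
  have := norm_le hC x
  rw [hx, norm_zero, mul_zero] at this
  exact norm_le_zero_iff.1 this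

/-- At level one, `f` is a uniform embedding of a complete space. -/
lemma isClosed_range {f : E →ₗ[ℂ] F} (hf : IsCompletelyBoundedBelow f) (hf' : f ∈ CB E F) :
    IsClosed (LinearMap.range f : Set F) := by
  obtain ⟨C, hC0, hC⟩ := hf
  obtain ⟨D, hD⟩ := hf'
  have h1 : AntilipschitzWith ⟨C, hC0.le⟩ f :=
    AddMonoidHomClass.antilipschitz_of_bound f (norm_le hC)
  have h2 : UniformContinuous f :=
    AddMonoidHomClass.uniformContinuous_of_bound f D (IsCompletelyBounded.norm_le hD)
  rw [LinearMap.coe_range]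
  exact h1.isClosed_range h2

lemma comp {f : E →ₗ[ℂ] F} {g : F →ₗ[ℂ] G} (hf : IsCompletelyBoundedBelow f)
    (hg : IsCompletelyBoundedBelow g) : IsCompletelyBoundedBelow (g ∘ₗ f) := by
  obtain ⟨C, hC0, hC⟩ := hf
  obtain ⟨D, hD0, hD⟩ := hg
  refine ⟨C * D, by positivity, fun n x => (hC n x).trans ?_⟩
  rw [mul_assoc, map_linearMap_comp]
  exact mul_le_mul_of_nonneg_left (hD n _) hC0.le

/-- `‖x‖ ≤ C ‖g f x‖ ≤ C D ‖f x‖`. This carries a bound from a concrete model back to an abstract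
pushout. -/
lemma of_comp {f : E →ₗ[ℂ] F} {g : F →ₗ[ℂ] G} (h : IsCompletelyBoundedBelow (g ∘ₗ f))
    (hg : g ∈ CB F G) : IsCompletelyBoundedBelow f := by
  obtain ⟨C, hC0, hC⟩ := h
  obtain ⟨D, hD0, hD⟩ := IsCompletelyBounded.exists_pos hg
  refine ⟨C * D, by positivity, fun n x => (hC n x).trans ?_⟩
  rw [mul_assoc, map_linearMap_comp]
  exact mul_le_mul_of_nonneg_left (hD n _) hC0.le

/-- The lift is `f⁻¹ ∘ k`; the lower bound of `f` is precisely a complete bound for `f⁻¹` on the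
range. -/
lemma exists_lift {f : E →ₗ[ℂ] F} (hf : IsCompletelyBoundedBelow f) {k : G →ₗ[ℂ] F}
    (hk : k ∈ CB G F) (h : ∀ x, k x ∈ LinearMap.range f) : ∃ l ∈ CB G E, f ∘ₗ l = k := by
  have hl : f ∘ₗ ((LinearEquiv.ofInjective f hf.injective).symm ∘ₗ
      k.codRestrict (LinearMap.range f) h) = k := by
    ext x
    exact congrArg Subtype.val
      ((LinearEquiv.ofInjective f hf.injective).apply_symm_apply ⟨k x, h x⟩)
  refine ⟨_, ?_, hl⟩
  obtain ⟨C, hC0, hC⟩ := hf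
  obtain ⟨D, hD⟩ := hk
  refine ⟨C * D, fun n x => (hC n _).trans ?_⟩
  rw [← map_linearMap_comp, hl, mul_assoc]
  exact mul_le_mul_of_nonneg_left (hD n _) hC0.le

end IsCompletelyBoundedBelow

namespace IsCompletelyOpen

lemma surjective {f : E →ₗ[ℂ] F} (hf : IsCompletelyOpen f) : Function.Surjective f := by
  obtain ⟨C, _, hC⟩ := hf
  intro y
  obtain ⟨x, hx, _⟩ := hC 1 (Matrix.of fun _ _ => y)
  exact ⟨x 0 0, congrFun (congrFun hx 0) 0⟩

lemma comp {f : E →ₗ[ℂ] F} {g : F →ₗ[ℂ] G} (hf : IsCompletelyOpen f)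
    (hg : IsCompletelyOpen g) : IsCompletelyOpen (g ∘ₗ f) := by
  obtain ⟨C, hC0, hC⟩ := hf
  obtain ⟨D, hD0, hD⟩ := hg
  refine ⟨C * D, by positivity, fun n z => ?_⟩
  obtain ⟨y, rfl, hy⟩ := hD n z
  obtain ⟨x, rfl, hx⟩ := hC n y
  refine ⟨x, rfl, hx.trans ?_⟩
  rw [mul_assoc]
  exact mul_le_mul_of_nonneg_left hy hC0.le

lemma of_comp {f : E →ₗ[ℂ] F} {g : F →ₗ[ℂ] G} (h : IsCompletelyOpen (g ∘ₗ f))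
    (hf : f ∈ CB E F) : IsCompletelyOpen g := by
  obtain ⟨C, hC0, hC⟩ := h
  obtain ⟨D, hD0, hD⟩ := IsCompletelyBounded.exists_pos hf
  refine ⟨D * C, by positivity, fun n z => ?_⟩
  obtain ⟨x, rfl, hx⟩ := hC n z
  refine ⟨x.map f, rfl, (hD n x).trans ?_⟩
  rw [mul_assoc]
  exact mul_le_mul_of_nonneg_left hx hD0.le

/-- The descended map is evaluated on a preimage of controlled norm, where it agrees with `k`. -/
lemma exists_desc {f : E →ₗ[ℂ] F} (hf : IsCompletelyOpen f) {k : E →ₗ[ℂ] G}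
    (hk : k ∈ CB E G) (h : LinearMap.ker f ≤ LinearMap.ker k) :
    ∃ l ∈ CB F G, l ∘ₗ f = k := by
  have hl : (Submodule.liftQ (LinearMap.ker f) k h ∘ₗ
      (f.quotKerEquivOfSurjective hf.surjective).symm.toLinearMap) ∘ₗ f = k := by
    ext x
    have : (f.quotKerEquivOfSurjective hf.surjective).symm (f x) =
        Submodule.Quotient.mk x := by
      rw [LinearEquiv.symm_apply_eq]
      rfl
    simp [this]
  refine ⟨_, ?_, hl⟩
  obtain ⟨C, hC0, hC⟩ := hf
  obtain ⟨D, hD0, hD⟩ := IsCompletelyBounded.exists_pos hk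
  refine ⟨D * C, fun n y => ?_⟩
  obtain ⟨x, rfl, hx⟩ := hC n y
  rw [← map_linearMap_comp, hl, mul_assoc]
  exact (hD n x).trans (mul_le_mul_of_nonneg_left hx hD0.le)

lemma mkQ (K : Submodule ℂ E) [IsClosed (K : Set E)] : IsCompletelyOpen K.mkQ := by
  -- The infimum need not be attained, so constant `1` may fail. Taking `ε = ‖x‖` gives `2`; this
  -- needs `x ≠ 0`, hence the case split.
  refine ⟨2, two_pos, fun n x => ?_⟩
  rcases (mnorm_nonneg n x).eq_or_lt with h | h
  · obtain rfl := OperatorSpace.eq_zero_of_mnorm n x h.symm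
    exact ⟨0, by ext; simp, by rw [mnorm_zero, mnorm_zero, mul_zero]⟩
  · obtain ⟨y, hy, hy'⟩ := exists_lift_mnorm_lt K x h
    exact ⟨y, hy, by linarith⟩

end IsCompletelyOpen

/-- The cobase change of a map that is completely bounded below is completely bounded below. -/
lemma IsCompletelyBoundedBelow.mkQ_comp_inr {f : E →ₗ[ℂ] F} {g : E →ₗ[ℂ] G}
    (hf : IsCompletelyBoundedBelow f) (hg : g ∈ CB E G)
    [IsClosed (LinearMap.range (f.prod (-g)) : Set (F × G))] :
    IsCompletelyBoundedBelow
      ((LinearMap.range (f.prod (-g))).mkQ ∘ₗ LinearMap.inr ℂ F G) := by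
  obtain ⟨C, hC0, hC⟩ := hf
  obtain ⟨D, hD0, hD⟩ := IsCompletelyBounded.exists_pos hg
  refine ⟨1 + D * C, by positivity, fun n z => ?_⟩
  refine le_mul_mnorm_quotient _ (by positivity) fun y hy => ?_
  -- A lift `y` of the class of `(0, z)` differs from it by some `(f x, -g x)`. Thus `y₁ = f x`
  -- controls `x`, and `z = y₂ + g x` gives the constant `1 + D * C`.
  have h : ∀ i j, ∃ x, f.prod (-g) x = y i j - (0, z i j) := fun i j =>
    (Submodule.Quotient.eq _).1 (congrFun (congrFun hy i) j)
  choose x hx using h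
  have h1 : y.map (LinearMap.fst ℂ F G) = (Matrix.of x).map f := by
    ext i j
    simpa using (congrArg Prod.fst (hx i j)).symm
  have h2 : z = y.map (LinearMap.snd ℂ F G) + (Matrix.of x).map g := by
    ext i j
    have h : -g (x i j) = (y i j).2 - z i j := congrArg Prod.snd (hx i j)
    change z i j = (y i j).2 + g (x i j)
    rw [neg_eq_iff_eq_neg.1 h]
    abel
  have h3 : MatrixNorm.mnorm n ((Matrix.of x).map f) ≤ MatrixNorm.mnorm n y :=
    h1 ▸ le_max_left _ _
  calc MatrixNorm.mnorm n z
      ≤ MatrixNorm.mnorm n (y.map (LinearMap.snd ℂ F G)) +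
        MatrixNorm.mnorm n ((Matrix.of x).map g) := by
        conv_lhs => rw [h2]
        exact OperatorSpace.mnorm_add_le n _ _
    _ ≤ MatrixNorm.mnorm n y + D * (C * MatrixNorm.mnorm n y) :=
        add_le_add (le_max_right _ _) ((hD n _).trans (mul_le_mul_of_nonneg_left
          ((hC n _).trans (mul_le_mul_of_nonneg_left h3 hC0.le)) hD0.le))
    _ = (1 + D * C) * MatrixNorm.mnorm n y := by ring

/-- The base change of a completely open map is completely open. -/
lemma IsCompletelyOpen.snd_comp_subtype {f : E →ₗ[ℂ] G} {g : F →ₗ[ℂ] G}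
    (hf : IsCompletelyOpen f) (hg : g ∈ CB F G)
    [IsClosed (LinearMap.ker (f ∘ₗ LinearMap.fst ℂ E F - g ∘ₗ LinearMap.snd ℂ E F) :
      Set (E × F))] :
    IsCompletelyOpen (LinearMap.snd ℂ E F ∘ₗ
      (LinearMap.ker (f ∘ₗ LinearMap.fst ℂ E F - g ∘ₗ LinearMap.snd ℂ E F)).subtype) := by
  obtain ⟨C, hC0, hC⟩ := hf
  obtain ⟨D, hD0, hD⟩ := IsCompletelyBounded.exists_pos hg
  refine ⟨max (C * D) 1, by positivity, fun n y => ?_⟩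
  -- A controlled `f`-preimage of `g y` pairs with `y` to a matrix over the pullback; the two
  -- coordinates account for `C * D` and `1`.
  obtain ⟨x, hx, hxy⟩ := hC n (y.map g)
  have h : ∀ i j, (x i j, y i j) ∈
      LinearMap.ker (f ∘ₗ LinearMap.fst ℂ E F - g ∘ₗ LinearMap.snd ℂ E F) := fun i j => by
    simpa [sub_eq_zero] using congrFun (congrFun hx i) j
  refine ⟨Matrix.of fun i j => ⟨(x i j, y i j), h i j⟩, rfl, max_le ?_ ?_⟩
  · calc MatrixNorm.mnorm n x ≤ C * MatrixNorm.mnorm n (y.map g) := hxy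
      _ ≤ C * (D * MatrixNorm.mnorm n y) := mul_le_mul_of_nonneg_left (hD n y) hC0.le
      _ = C * D * MatrixNorm.mnorm n y := by ring
      _ ≤ max (C * D) 1 * MatrixNorm.mnorm n y :=
        mul_le_mul_of_nonneg_right (le_max_left _ _) (mnorm_nonneg n y)
  · exact le_mul_of_one_le_left (mnorm_nonneg n y) (le_max_right _ _)

end CompleteBounds

end OpMod

namespace OpMod

open CategoryTheory CategoryTheory.Limits

/-! ### The category of operator spaces and its maximal exact structure. -/

namespace Op

/-- The linear map underlying a morphism of operator spaces. -/
def toLin {X Y : Op.{u}} (f : X ⟶ Y) : X.carrier →ₗ[ℂ] Y.carrier := Subtype.val f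

lemma toLin_mem {X Y : Op.{u}} (f : X ⟶ Y) : toLin f ∈ CB X.carrier Y.carrier := Subtype.property f

/-- A completely bounded map as a morphism of operator spaces. -/
def ofHom {X Y : Op.{u}} (f : X.carrier →ₗ[ℂ] Y.carrier) (hf : f ∈ CB X.carrier Y.carrier) :
    X ⟶ Y := ⟨f, hf⟩

lemma hom_ext {X Y : Op.{u}} {f g : X ⟶ Y} (h : toLin f = toLin g) : f = g := Subtype.ext h

lemma toLin_comp {X Y Z : Op.{u}} (f : X ⟶ Y) (g : Y ⟶ Z) :
    toLin (f ≫ g) = toLin g ∘ₗ toLin f := rfl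

lemma mono_of_injective {X Y : Op.{u}} {f : X ⟶ Y} (hf : Function.Injective (toLin f)) :
    Mono f :=
  ⟨fun _ _ h => hom_ext <| LinearMap.ext fun x => hf (LinearMap.congr_fun (congrArg toLin h) x)⟩

lemma epi_of_surjective {X Y : Op.{u}} {f : X ⟶ Y} (hf : Function.Surjective (toLin f)) :
    Epi f :=
  ⟨fun _ _ h => hom_ext <| LinearMap.ext <| hf.forall.2 <|
    LinearMap.congr_fun (congrArg toLin h)⟩

instance {X Y : Op.{u}} (f : X ⟶ Y) : IsClosed (LinearMap.ker (toLin f) : Set X.carrier) :=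
  isClosed_ker_of_mem_CB (toLin_mem f)

instance {E : Type*} [NormedAddCommGroup E] [NormedSpace ℂ E] (K : Submodule ℂ E) :
    IsClosed (K.topologicalClosure : Set E) := K.isClosed_topologicalClosure

/-- The kernel of a completely bounded map, with the subspace structure. -/
noncomputable def kernelObj {X Y : Op.{u}} (f : X ⟶ Y) : Op.{u} := ⟨LinearMap.ker (toLin f)⟩

/-- The inclusion of the kernel. -/
noncomputable def kernelι {X Y : Op.{u}} (f : X ⟶ Y) : kernelObj f ⟶ X :=
  ofHom (LinearMap.ker (toLin f)).subtype (subtype_mem_CB _)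

lemma kernelι_comp {X Y : Op.{u}} (f : X ⟶ Y) : kernelι f ≫ f = 0 :=
  hom_ext <| LinearMap.ext fun x => x.2

instance {X Y : Op.{u}} (f : X ⟶ Y) : Mono (kernelι f) :=
  mono_of_injective Subtype.val_injective

lemma comp_apply_eq_zero {X Y Z : Op.{u}} {f : X ⟶ Y} {g : Y ⟶ Z} (h : f ≫ g = 0)
    (x : X.carrier) : toLin g (toLin f x) = 0 :=
  LinearMap.congr_fun (congrArg toLin h) x

/-- The universal property of the kernel. -/
noncomputable def kernelIsLimit {X Y : Op.{u}} (f : X ⟶ Y) :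
    IsLimit (KernelFork.ofι (kernelι f) (kernelι_comp f)) :=
  KernelFork.IsLimit.ofι' _ _ fun k hk =>
    ⟨ofHom ((toLin k).codRestrict _ (comp_apply_eq_zero hk))
      (codRestrict_mem_CB _ (toLin_mem k) (comp_apply_eq_zero hk)), rfl⟩

/-- The cokernel of a completely bounded map: the quotient by the closure of the range. -/
noncomputable def cokernelObj {X Y : Op.{u}} (f : X ⟶ Y) : Op.{u} :=
  ⟨Y.carrier ⧸ (LinearMap.range (toLin f)).topologicalClosure⟩

/-- The projection onto the cokernel. -/
noncomputable def cokernelπ {X Y : Op.{u}} (f : X ⟶ Y) : Y ⟶ cokernelObj f :=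
  ofHom (LinearMap.range (toLin f)).topologicalClosure.mkQ (mkQ_mem_CB _)

lemma comp_cokernelπ {X Y : Op.{u}} (f : X ⟶ Y) : f ≫ cokernelπ f = 0 :=
  hom_ext <| LinearMap.ext fun x => (Submodule.Quotient.mk_eq_zero _).2
    (Submodule.le_topologicalClosure _ (LinearMap.mem_range_self _ x))

instance {X Y : Op.{u}} (f : X ⟶ Y) : Epi (cokernelπ f) :=
  epi_of_surjective (Submodule.mkQ_surjective _)

lemma closure_range_le_ker {X Y Z : Op.{u}} {f : X ⟶ Y} {g : Y ⟶ Z} (h : f ≫ g = 0) :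
    (LinearMap.range (toLin f)).topologicalClosure ≤ LinearMap.ker (toLin g) :=
  Submodule.topologicalClosure_minimal _
    (by rintro _ ⟨x, rfl⟩; exact comp_apply_eq_zero h x) (isClosed_ker_of_mem_CB (toLin_mem g))

/-- The universal property of the cokernel. -/
noncomputable def cokernelIsColimit {X Y : Op.{u}} (f : X ⟶ Y) :
    IsColimit (CokernelCofork.ofπ (cokernelπ f) (comp_cokernelπ f)) :=
  CokernelCofork.IsColimit.ofπ' _ _ fun k hk =>
    ⟨ofHom (Submodule.liftQ _ (toLin k) (closure_range_le_ker hk))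
      (liftQ_mem_CB _ (toLin_mem k) _), hom_ext (Submodule.liftQ_mkQ _ _ _)⟩

instance : HasKernels Op.{u} := ⟨fun f => ⟨_, kernelIsLimit f⟩⟩

instance : HasCokernels Op.{u} := ⟨fun f => ⟨_, cokernelIsColimit f⟩⟩

instance : HasZeroObject Op.{u} :=
  ⟨⟨PUnit⟩, (IsZero.iff_id_eq_zero _).2 (hom_ext (LinearMap.ext fun _ => rfl))⟩

/-- The product of operator spaces is a biproduct. -/
noncomputable def biprodBicone (X Y : Op.{u}) : BinaryBicone X Y where
  pt := ⟨X.carrier × Y.carrier⟩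
  fst := ofHom (LinearMap.fst ℂ _ _) fst_mem_CB
  snd := ofHom (LinearMap.snd ℂ _ _) snd_mem_CB
  inl := ofHom (LinearMap.inl ℂ _ _) inl_mem_CB
  inr := ofHom (LinearMap.inr ℂ _ _) inr_mem_CB

instance : HasBinaryBiproducts Op.{u} where
  has_binary_biproduct X Y := ⟨⟨biprodBicone X Y, isBinaryBilimitOfTotal _
    (hom_ext (LinearMap.ext fun x => Prod.ext (add_zero x.1) (zero_add x.2)))⟩⟩

/-- A kernel of `π` is isomorphic to the subspace `ker π`, whose inclusion is completely isometric.
Conversely, a map bounded below has closed range, so the kernel of its cokernel is that range and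
maps into it lift. -/
lemma admissibleMono_Emax_iff {X Y : Op.{u}} (f : X ⟶ Y) :
    AdmissibleMono (Emax Op.{u}) f ↔ IsCompletelyBoundedBelow (toLin f) := by
  constructor
  · rintro ⟨Z, π, w, h⟩
    obtain ⟨l, hl⟩ := h.exists_lift (kernelι π) (kernelι_comp π)
    obtain ⟨k, hk⟩ := KernelFork.IsLimit.lift' (kernelIsLimit π) f w
    have := h.mono_f
    -- One composite suffices: `‖x‖ = ‖l k x‖ ≤ C ‖k x‖ = C ‖f x‖`.
    have hkl : k ≫ l = 𝟙 X := by
      rw [← cancel_mono f]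
      exact (Category.assoc _ _ _).trans ((congrArg (k ≫ ·) hl).trans
        (hk.trans (Category.id_comp f).symm))
    obtain ⟨C, hC0, hC⟩ := IsCompletelyBounded.exists_pos (toLin_mem l)
    refine ⟨C, hC0, fun n x => ?_⟩
    have h1 : (x.map (toLin k)).map (toLin l) = x := by
      rw [← map_linearMap_comp, ← toLin_comp, hkl]
      rfl
    have h2 : MatrixNorm.mnorm n (x.map (toLin k)) = MatrixNorm.mnorm n (x.map (toLin f)) := by
      rw [← hk]
      rfl
    calc MatrixNorm.mnorm n x = MatrixNorm.mnorm n ((x.map (toLin k)).map (toLin l)) := by rw [h1]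
      _ ≤ _ := hC n _
      _ = _ := by rw [h2]
  · intro hf
    have := mono_of_injective hf.injective
    refine ⟨_, cokernelπ f, comp_cokernelπ f, ⟨KernelFork.IsLimit.ofι' _ _ fun k hk => ?_⟩,
      ⟨cokernelIsColimit f⟩⟩
    have h : ∀ x, toLin k x ∈ LinearMap.range (toLin f) := fun x => by
      have h := (Submodule.Quotient.mk_eq_zero _).1 (comp_apply_eq_zero hk x)
      rwa [(hf.isClosed_range (toLin_mem f)).submodule_topologicalClosure_eq] at h
    have h' := hf.exists_lift (toLin_mem k) h
    exact ⟨ofHom h'.choose h'.choose_spec.1, hom_ext h'.choose_spec.2⟩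

/-- A cokernel is a quotient map up to isomorphism, and quotient maps are completely open.
Conversely, complete openness lets every map vanishing on `ker f` descend. -/
lemma admissibleEpi_Emax_iff {X Y : Op.{u}} (f : X ⟶ Y) :
    AdmissibleEpi (Emax Op.{u}) f ↔ IsCompletelyOpen (toLin f) := by
  constructor
  · rintro ⟨Z, μ, w, h⟩
    obtain ⟨l, hl⟩ := h.exists_desc (cokernelπ μ) (comp_cokernelπ μ)
    obtain ⟨k, hk⟩ := CokernelCofork.IsColimit.desc' (cokernelIsColimit μ) f w
    have := h.epi_g
    have hkl : l ≫ k = 𝟙 Y := by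
      rw [← cancel_epi f]
      exact (Category.assoc _ _ _).symm.trans ((congrArg (· ≫ k) hl).trans
        (hk.trans (Category.comp_id f).symm))
    obtain ⟨C, hC0, hC⟩ := IsCompletelyBounded.exists_pos (toLin_mem l)
    obtain ⟨D, hD0, hD⟩ := IsCompletelyOpen.mkQ (LinearMap.range (toLin μ)).topologicalClosure
    refine ⟨D * C, by positivity, fun n y => ?_⟩
    -- As `f = cokernelπ μ ≫ k` and `l ≫ k = 𝟙`, a lift of `l y` along the quotient map is an
    -- `f`-preimage of `y`.
    obtain ⟨x, hx, hxy⟩ := hD n (y.map (toLin l))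
    refine ⟨x, ?_, hxy.trans ?_⟩
    · calc x.map (toLin f) = (x.map (toLin (cokernelπ μ))).map (toLin k) := by rw [← hk]; rfl
        _ = (y.map (toLin l)).map (toLin k) := congrArg (Matrix.map · (toLin k)) hx
        _ = y := by
          rw [← map_linearMap_comp, ← toLin_comp, hkl]
          rfl
    · rw [mul_assoc]
      exact mul_le_mul_of_nonneg_left (hC n y) hD0.le
  · intro hf
    have := epi_of_surjective hf.surjective
    refine ⟨_, kernelι f, kernelι_comp f, ⟨kernelIsLimit f⟩,
      ⟨CokernelCofork.IsColimit.ofπ' _ _ fun k hk => ?_⟩⟩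
    have h : LinearMap.ker (toLin f) ≤ LinearMap.ker (toLin k) := fun x hx =>
      comp_apply_eq_zero hk ⟨x, hx⟩
    have h' := hf.exists_desc (toLin_mem k) h
    exact ⟨ofHom h'.choose h'.choose_spec.1, hom_ext h'.choose_spec.2⟩

/-- The range of `(f, -g)` is closed because `f` is bounded below, so the quotient `Q` by it needs
no closure. `Q` is only used as a cocone: `b` factors through `inr` and is bounded below, hence so
is `inr`. -/
lemma isCompletelyBoundedBelow_of_isPushout {X Y Z P : Op.{u}} {f : X ⟶ Y} {g : X ⟶ Z}
    {inl : Y ⟶ P} {inr : Z ⟶ P} (h : IsPushout f g inl inr)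
    (hf : IsCompletelyBoundedBelow (toLin f)) : IsCompletelyBoundedBelow (toLin inr) := by
  set T := (toLin f).prod (-toLin g) with hT
  have hT1 : T ∈ CB X.carrier (Y.carrier × Z.carrier) :=
    prod_mem_CB (toLin_mem f) ((CB _ _).neg_mem (toLin_mem g))
  have hT2 : IsCompletelyBoundedBelow T :=
    IsCompletelyBoundedBelow.of_comp (g := LinearMap.fst ℂ _ _) hf fst_mem_CB
  have hT3 := hT2.isClosed_range hT1
  let Q : Op.{u} := ⟨(Y.carrier × Z.carrier) ⧸ LinearMap.range T⟩
  let a : Y ⟶ Q := ofHom ((LinearMap.range T).mkQ ∘ₗ LinearMap.inl ℂ _ _)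
    (comp_mem_CB inl_mem_CB (mkQ_mem_CB _))
  let b : Z ⟶ Q := ofHom ((LinearMap.range T).mkQ ∘ₗ LinearMap.inr ℂ _ _)
    (comp_mem_CB inr_mem_CB (mkQ_mem_CB _))
  have hab : f ≫ a = g ≫ b := hom_ext <| LinearMap.ext fun x =>
    (Submodule.Quotient.eq _).2 ⟨x, by simp [hT, Prod.ext_iff]; exact ⟨rfl, rfl⟩⟩
  have hb : IsCompletelyBoundedBelow (toLin b) := hf.mkQ_comp_inr (toLin_mem g)
  rw [← h.inr_desc a b hab] at hb
  exact hb.of_comp (toLin_mem _)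

/-- Dually, the concrete `Q` only has to be a cone: the completely open `b` factors through `snd`.
-/
lemma isCompletelyOpen_of_isPullback {X Y Z P : Op.{u}} {f : X ⟶ Z} {g : Y ⟶ Z}
    {fst : P ⟶ X} {snd : P ⟶ Y} (h : IsPullback fst snd f g)
    (hf : IsCompletelyOpen (toLin f)) : IsCompletelyOpen (toLin snd) := by
  set T := toLin f ∘ₗ LinearMap.fst ℂ X.carrier Y.carrier -
    toLin g ∘ₗ LinearMap.snd ℂ X.carrier Y.carrier with hT
  have hT1 : T ∈ CB (X.carrier × Y.carrier) Z.carrier :=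
    (CB _ _).sub_mem (comp_mem_CB fst_mem_CB (toLin_mem f)) (comp_mem_CB snd_mem_CB (toLin_mem g))
  have hT3 := isClosed_ker_of_mem_CB hT1
  let Q : Op.{u} := ⟨LinearMap.ker T⟩
  let a : Q ⟶ X := ofHom (LinearMap.fst ℂ _ _ ∘ₗ (LinearMap.ker T).subtype)
    (comp_mem_CB (subtype_mem_CB _) fst_mem_CB)
  let b : Q ⟶ Y := ofHom (LinearMap.snd ℂ _ _ ∘ₗ (LinearMap.ker T).subtype)
    (comp_mem_CB (subtype_mem_CB _) snd_mem_CB)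
  have hab : a ≫ f = b ≫ g := hom_ext <| LinearMap.ext fun x => sub_eq_zero.1 x.2
  have hb : IsCompletelyOpen (toLin b) := hf.snd_comp_subtype (toLin_mem g)
  rw [← h.lift_snd a b hab] at hb
  exact hb.of_comp (toLin_mem _)

/-- All kernel-cokernel pairs of operator spaces form an exact structure. -/
theorem isExactCategory_Emax : IsExactCategory (Emax Op.{u}) where
  hasZeroObject := inferInstance
  hasBinaryProducts := inferInstance
  isExactStructure :=
    { isKernelCokernelPair := fun _ h => h
      of_iso := fun _ _ ⟨e⟩ h => h.of_iso e
      id_mono := fun X => (admissibleMono_Emax_iff _).2 ⟨1, one_pos, fun n x => (one_mul _).ge⟩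
      id_epi := fun X => (admissibleEpi_Emax_iff _).2
        ⟨1, one_pos, fun n x => ⟨x, rfl, (one_mul _).ge⟩⟩
      comp_mono := fun f g hf hg => by
        rw [admissibleMono_Emax_iff] at *
        exact hf.comp hg
      comp_epi := fun f g hf hg => by
        rw [admissibleEpi_Emax_iff] at *
        exact hf.comp hg
      pushout := fun f g hf => by
        have := hasPushouts_of_hasCokernels Op.{u}
        refine ⟨inferInstance, fun inl inr h => ?_⟩
        rw [admissibleMono_Emax_iff] at *
        exact isCompletelyBoundedBelow_of_isPushout h hf
      pullback := fun f g hf => by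
        have := hasPullbacks_of_hasKernels Op.{u}
        refine ⟨inferInstance, fun fst snd h => ?_⟩
        rw [admissibleEpi_Emax_iff] at *
        exact isCompletelyOpen_of_isPullback h hf }

end Op

end OpMod

namespace OpMod

/-! ### Operator modules: the action and the approximate identity. -/

open Filter Topology TensorProduct

variable {H : Type*} [NormedAddCommGroup H] [InnerProductSpace ℂ H] [CompleteSpace H]
  {A : OperatorAlgebra H}

lemma rectNorm_alg_nonneg {m n : ℕ} (y : Matrix (Fin m) (Fin n) A.alg) : 0 ≤ rectNorm y :=
  norm_nonneg (matrixToCLM ((corner y).map Subtype.val))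

lemma matrixToCLM_apply {H : Type*} [NormedAddCommGroup H] [InnerProductSpace ℂ H] {n : ℕ}
    (a : Matrix (Fin n) (Fin n) (H →L[ℂ] H))
    (v : PiLp 2 (fun _ : Fin n => H)) (i : Fin n) : matrixToCLM a v i = ∑ j, a i j (v j) := by
  simp [matrixToCLM]

/-- The padded operator on `H²` sends `(v₀, v₁)` to `(a v₁, 0)`. -/
lemma rectNorm_alg_single_le (a : A.alg) :
    rectNorm (Matrix.of fun (_ : Fin 1) (_ : Fin 1) => a) ≤ ‖a‖ := by
  refine ContinuousLinearMap.opNorm_le_bound _ (norm_nonneg a) fun v => ?_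
  set T := matrixToCLM ((corner (Matrix.of fun (_ : Fin 1) (_ : Fin 1) => a)).map Subtype.val)
  have e0 : finSumFinEquiv.symm (0 : Fin (1 + 1)) = Sum.inl 0 := rfl
  have e1 : finSumFinEquiv.symm (1 : Fin (1 + 1)) = Sum.inr 0 := rfl
  have h0 : T v 0 = (a : H →L[ℂ] H) (v 1) := by
    simp [T, matrixToCLM_apply, corner, Fin.sum_univ_two, e0, e1]
  have h1 : T v 1 = 0 := by
    simp [T, matrixToCLM_apply, corner, Fin.sum_univ_two, e0, e1]
  have h2 : ‖T v‖ = ‖T v 0‖ := by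
    rw [PiLp.norm_eq_of_L2, Fin.sum_univ_two]
    erw [h1]
    simp
  calc ‖T v‖ = ‖(a : H →L[ℂ] H) (v 1)‖ := by rw [h2, h0]
    _ ≤ ‖(a : H →L[ℂ] H)‖ * ‖v 1‖ := ContinuousLinearMap.le_opNorm _ _
    _ ≤ ‖a‖ * ‖v‖ := mul_le_mul_of_nonneg_left (PiLp.norm_apply_le v 1) (norm_nonneg _)

section Action

variable {E : Type*} [NormedAddCommGroup E] [NormedSpace ℂ E]

/-- The product of a rectangular matrix over `E` and one over `A` under a bilinear action. -/
def matAct (act : E →ₗ[ℂ] A.alg →ₗ[ℂ] E) {n p : ℕ} (x : Matrix (Fin n) (Fin p) E)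
    (y : Matrix (Fin p) (Fin n) A.alg) : Matrix (Fin n) (Fin n) E :=
  Matrix.of fun i j => ∑ k, act (x i k) (y k j)

lemma map_lift_matTensor (act : E →ₗ[ℂ] A.alg →ₗ[ℂ] E) {n p : ℕ} (x : Matrix (Fin n) (Fin p) E)
    (y : Matrix (Fin p) (Fin n) A.alg) :
    (matTensor x y).map (TensorProduct.lift act) = matAct act x y := by
  ext i j
  simp [matTensor, matAct]

/-- Reduces non-degeneracy of subspaces, quotients and products to `x · e → x`. -/
lemma dense_span_of_tendsto (act : E →ₗ[ℂ] A.alg →ₗ[ℂ] E) {l : Filter A.alg} [l.NeBot]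
    (h : ∀ x, Tendsto (fun e => act x e) l (𝓝 x)) :
    Dense (Submodule.span ℂ {y : E | ∃ x a, y = act x a} : Set E) := fun x =>
  mem_closure_of_tendsto (h x) (Eventually.of_forall fun e => Submodule.subset_span ⟨x, e, rfl⟩)

variable [OperatorSpace E]

/-- The Haagerup norm is an infimum over factorisations, so being below it means being below each
term. Tensors thus disappear in favour of matrix products. -/
lemma completelyContractive_iff (act : E →ₗ[ℂ] A.alg →ₗ[ℂ] E) :
    (∀ (n : ℕ) (u : Matrix (Fin n) (Fin n) (E ⊗[ℂ] A.alg)),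
      ENNReal.ofReal (MatrixNorm.mnorm n (u.map (TensorProduct.lift act))) ≤ haagerupNorm u) ↔
    ∀ (n p : ℕ) (x : Matrix (Fin n) (Fin p) E) (y : Matrix (Fin p) (Fin n) A.alg),
      MatrixNorm.mnorm n (matAct act x y) ≤ rectNorm x * rectNorm y := by
  constructor
  · intro h n p x y
    have h1 := (h n (matTensor x y)).trans (iInf_le_of_le p (iInf_le_of_le x (iInf_le_of_le y
      (iInf_le _ rfl))))
    rw [map_lift_matTensor] at h1
    exact (ENNReal.ofReal_le_ofReal_iff
      (mul_nonneg (rectNorm_nonneg x) (rectNorm_alg_nonneg y))).1 h1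
  · intro h n u
    refine le_iInf fun p => le_iInf fun x => le_iInf fun y => le_iInf fun hu => ?_
    rw [hu, map_lift_matTensor]
    exact ENNReal.ofReal_le_ofReal (h n p x y)

variable [OperatorModule A E]

lemma mnorm_matAct_le {n p : ℕ} (x : Matrix (Fin n) (Fin p) E)
    (y : Matrix (Fin p) (Fin n) A.alg) :
    MatrixNorm.mnorm n (matAct OperatorModule.act x y) ≤ rectNorm x * rectNorm y :=
  (completelyContractive_iff _).1 OperatorModule.completelyContractive n p x y

lemma norm_act_le (x : E) (a : A.alg) : ‖OperatorModule.act x a‖ ≤ ‖x‖ * ‖a‖ := by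
  have h := mnorm_matAct_le (Matrix.of fun (_ : Fin 1) (_ : Fin 1) => x)
    (Matrix.of fun (_ : Fin 1) (_ : Fin 1) => a)
  have h1 : matAct OperatorModule.act (Matrix.of fun (_ : Fin 1) (_ : Fin 1) => x)
    (Matrix.of fun (_ : Fin 1) (_ : Fin 1) => a) =
      Matrix.of fun _ _ => OperatorModule.act x a := by
    ext i j
    simp [matAct]
  rw [h1, OperatorSpace.mnorm_one] at h
  exact h.trans (mul_le_mul (rectNorm_single_le x) (rectNorm_alg_single_le a)
    (rectNorm_alg_nonneg _) (norm_nonneg x))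

lemma continuous_act_left (a : A.alg) : Continuous fun x : E => OperatorModule.act x a :=
  AddMonoidHomClass.continuous_of_bound (OperatorModule.act.flip a) ‖a‖
    fun x => (norm_act_le x a).trans (mul_comm _ _).le

lemma continuous_act_right (x : E) : Continuous fun a : A.alg => OperatorModule.act x a :=
  AddMonoidHomClass.continuous_of_bound (OperatorModule.act x) ‖x‖ fun a => norm_act_le x a

/-- A contractive approximate identity of `A` converges pointwise to the identity on a
non-degenerate module. -/
lemma tendsto_act {l : Filter A.alg} (hl : l.IsApproximateUnit) (hl' : ∀ᶠ e in l, ‖e‖ ≤ 1)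
    (x : E) : Tendsto (fun e => OperatorModule.act x e) l (𝓝 x) := by
  -- On products, `(x · a) · e = x · (a e) → x · a`. The bound `‖e‖ ≤ 1` then extends convergence
  -- from the dense span by an `ε / 3` argument.
  have hspan : ∀ y ∈ Submodule.span ℂ {y : E | ∃ x, ∃ a : A.alg, y = OperatorModule.act x a},
      Tendsto (fun e => OperatorModule.act y e) l (𝓝 y) := by
    intro y hy
    induction hy using Submodule.span_induction with
    | mem y hy =>
      obtain ⟨x, a, rfl⟩ := hy
      simp_rw [← OperatorModule.act_mul]
      exact ((continuous_act_right x).tendsto a).comp (hl.tendsto_mul_left a)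
    | zero => simpa using tendsto_const_nhds
    | add y z _ _ hy hz => simpa using hy.add hz
    | smul c y _ hy => simpa using hy.const_smul c
  rw [Metric.tendsto_nhds]
  intro ε hε
  obtain ⟨y, hy, hxy⟩ := Metric.dense_iff.1 (OperatorModule.nondegenerate (A := A) (E := E)) x
    (ε / 3) (by positivity)
  filter_upwards [Metric.tendsto_nhds.1 (hspan y hxy) (ε / 3) (by positivity), hl'] with e h1 h2
  rw [Metric.mem_ball, dist_eq_norm] at hy
  rw [dist_eq_norm] at h1 ⊢
  have h3 : OperatorModule.act x e - x =
      -OperatorModule.act (y - x) e + (OperatorModule.act y e - y) + (y - x) := by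
    simp only [map_sub, LinearMap.sub_apply]
    abel
  have h4 : ‖OperatorModule.act (y - x) e‖ ≤ ‖y - x‖ :=
    (norm_act_le _ _).trans (mul_le_of_le_one_right (norm_nonneg _) h2)
  calc ‖OperatorModule.act x e - x‖ ≤
      ‖OperatorModule.act (y - x) e‖ + ‖OperatorModule.act y e - y‖ + ‖y - x‖ := by
        rw [h3, ← norm_neg (OperatorModule.act (y - x) e)]
        exact norm_add₃_le
    _ < ε := by linarith

end Action

/-! ### Submodules, quotient modules and products. -/

section Constructions

variable {E F : Type*} [NormedAddCommGroup E] [NormedSpace ℂ E] [OperatorSpace E]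
  [OperatorModule A E] [NormedAddCommGroup F] [NormedSpace ℂ F] [OperatorSpace F]
  [OperatorModule A F]

/-- The module structure on a closed submodule. -/
@[reducible]
noncomputable def OperatorModule.ofSubmodule (K : Submodule ℂ E) [IsClosed (K : Set E)]
    (hK : ∀ x ∈ K, ∀ a : A.alg, OperatorModule.act x a ∈ K) : OperatorModule A K where
  act := LinearMap.mk₂ ℂ (fun x a => ⟨OperatorModule.act (x : E) a, hK x x.2 a⟩)
    (fun x y a => Subtype.ext (by simp)) (fun c x a => Subtype.ext (by simp))
    (fun x a b => Subtype.ext (by simp)) (fun c x a => Subtype.ext (by simp))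
  act_mul x a b := Subtype.ext (OperatorModule.act_mul (x : E) a b)
  completelyContractive := (completelyContractive_iff _).2 fun n p x y => by
    have h : rectNorm x = rectNorm (x.map K.subtype) := by
      rw [rectNorm_eq, rectNorm_eq, mnorm_subspace, map_corner]
    rw [h, mnorm_subspace]
    refine le_of_eq_of_le (congrArg _ ?_) (mnorm_matAct_le (x.map K.subtype) y)
    ext i j
    simp [matAct]
  nondegenerate := by
    obtain ⟨l, hl, hl'⟩ := A.exists_cai
    have := hl.neBot
    -- The convergence takes place in `E`, but all `x · e` lie in `K`, which carries the subspace
    -- topology.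
    exact dense_span_of_tendsto _ fun x => tendsto_subtype_rng.2 (tendsto_act hl hl' (x : E))

/-- The action on the quotient by an invariant subspace. -/
noncomputable def quotientAct (K : Submodule ℂ E)
    (hK : ∀ x ∈ K, ∀ a : A.alg, OperatorModule.act x a ∈ K) :
    (E ⧸ K) →ₗ[ℂ] A.alg →ₗ[ℂ] (E ⧸ K) :=
  K.liftQ (OperatorModule.act.compr₂ K.mkQ) fun x hx => LinearMap.ext fun a =>
    (Submodule.Quotient.mk_eq_zero K).2 (hK x hx a)

/-- The module structure on the quotient by a closed submodule. -/
@[reducible]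
noncomputable def OperatorModule.ofQuotient (K : Submodule ℂ E) [IsClosed (K : Set E)]
    (hK : ∀ x ∈ K, ∀ a : A.alg, OperatorModule.act x a ∈ K) : OperatorModule A (E ⧸ K) where
  act := quotientAct K hK
  act_mul x a b := by
    obtain ⟨x, rfl⟩ := K.mkQ_surjective x
    exact congrArg K.mkQ (OperatorModule.act_mul x a b)
  completelyContractive := (completelyContractive_iff _).2 fun n p x y => by
    rw [rectNorm_eq, mul_comm]
    refine le_mul_mnorm_quotient K (rectNorm_alg_nonneg y) fun z hz => ?_
    -- `z` lifts the padded square matrix and may be nonzero off the corner; cutting to the corner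
    -- lifts `x` without increasing the norm.
    set x' := z.submatrix (Fin.castAdd p) (Fin.natAdd n) with hx'
    have hx : x = x'.map K.mkQ := by
      rw [hx', ← Matrix.submatrix_map, hz]
      ext i j
      simp [corner]
    have h : matAct (quotientAct K hK) x y = (matAct OperatorModule.act x' y).map K.mkQ := by
      ext i j
      rw [hx, Matrix.map_apply, matAct, matAct, Matrix.of_apply, Matrix.of_apply, map_sum]
      rfl
    rw [h, mul_comm]
    exact (mnorm_map_mkQ_le K _).trans ((mnorm_matAct_le x' y).trans
      (mul_le_mul_of_nonneg_right (rectNorm_toBlocks₁₂_le z) (rectNorm_alg_nonneg y)))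
  nondegenerate := by
    obtain ⟨l, hl, hl'⟩ := A.exists_cai
    have := hl.neBot
    have h : ∀ x, Tendsto (fun e => quotientAct K hK x e) l (𝓝 x) := K.mkQ_surjective.forall.2
      fun x => ((IsCompletelyBounded.continuous (mkQ_mem_CB K)).tendsto x).comp
        (tendsto_act hl hl' x)
    exact dense_span_of_tendsto _ h

variable (E F) in
/-- The componentwise action on a product. -/
noncomputable def prodAct : (E × F) →ₗ[ℂ] A.alg →ₗ[ℂ] (E × F) :=
  LinearMap.mk₂ ℂ (fun x a => (OperatorModule.act x.1 a, OperatorModule.act x.2 a))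
    (fun x y a => by simp) (fun c x a => by simp) (fun x a b => by simp) (fun c x a => by simp)

lemma prodAct_apply (x : E × F) (a : A.alg) :
    prodAct E F x a = (OperatorModule.act x.1 a, OperatorModule.act x.2 a) := rfl

lemma rectNorm_prod {n p : ℕ} (x : Matrix (Fin n) (Fin p) (E × F)) :
    rectNorm x = max (rectNorm (x.map (LinearMap.fst ℂ E F)))
      (rectNorm (x.map (LinearMap.snd ℂ E F))) := by
  rw [rectNorm_eq, rectNorm_eq, rectNorm_eq, mnorm_prod, map_corner, map_corner]

lemma mnorm_matAct_prodAct_le {n p : ℕ} (x : Matrix (Fin n) (Fin p) (E × F))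
    (y : Matrix (Fin p) (Fin n) A.alg) :
    MatrixNorm.mnorm n (matAct (prodAct E F) x y) ≤ rectNorm x * rectNorm y := by
  have h1 : (matAct (prodAct E F) x y).map (LinearMap.fst ℂ E F) =
      matAct OperatorModule.act (x.map (LinearMap.fst ℂ E F)) y := by
    ext i j
    simp [matAct, prodAct_apply, Prod.fst_sum]
  have h2 : (matAct (prodAct E F) x y).map (LinearMap.snd ℂ E F) =
      matAct OperatorModule.act (x.map (LinearMap.snd ℂ E F)) y := by
    ext i j
    simp [matAct, prodAct_apply, Prod.snd_sum]
  rw [rectNorm_prod, max_mul_of_nonneg _ _ (rectNorm_alg_nonneg y), mnorm_prod, h1, h2]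
  exact max_le_max (mnorm_matAct_le _ y) (mnorm_matAct_le _ y)

/-- The product of two modules. -/
noncomputable instance : OperatorModule A (E × F) where
  act := prodAct E F
  act_mul x a b := Prod.ext (OperatorModule.act_mul x.1 a b) (OperatorModule.act_mul x.2 a b)
  completelyContractive := (completelyContractive_iff _).2 fun _ _ x y =>
    mnorm_matAct_prodAct_le x y
  nondegenerate := by
    obtain ⟨l, hl, hl'⟩ := A.exists_cai
    have := hl.neBot
    have h : ∀ x, Tendsto (fun e => prodAct E F x e) l (𝓝 x) := fun x =>
      (tendsto_act hl hl' x.1).prodMk_nhds (tendsto_act hl hl' x.2)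
    exact dense_span_of_tendsto _ h

/-- The zero module. -/
noncomputable instance : OperatorModule A PUnit.{u + 1} where
  act := 0
  act_mul _ _ _ := rfl
  completelyContractive := (completelyContractive_iff _).2 fun n p x y =>
    mul_nonneg (rectNorm_nonneg x) (rectNorm_alg_nonneg y)
  nondegenerate x := by
    rw [Subsingleton.elim x 0]
    exact subset_closure (Submodule.zero_mem _)

end Constructions

end OpMod

namespace OpMod

open CategoryTheory CategoryTheory.Limits

variable {H : Type w} [NormedAddCommGroup H] [InnerProductSpace ℂ H] [CompleteSpace H]
  {A : OperatorAlgebra H}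

/-! ### The category of operator modules and the forgetful functor. -/

namespace OMod

/-- The linear map underlying a morphism of modules. -/
def toLin {X Y : OMod.{u} A} (f : X ⟶ Y) : X.carrier →ₗ[ℂ] Y.carrier := Subtype.val f

lemma toLin_mem {X Y : OMod.{u} A} (f : X ⟶ Y) : toLin f ∈ CB X.carrier Y.carrier :=
  (Subtype.property f).1

lemma toLin_act {X Y : OMod.{u} A} (f : X ⟶ Y) (x : X.carrier) (a : A.alg) :
    toLin f (OperatorModule.act x a) = OperatorModule.act (toLin f x) a :=
  (Subtype.property f).2 x a

/-- A completely bounded module map as a morphism of modules. -/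
def ofHom {X Y : OMod.{u} A} (f : X.carrier →ₗ[ℂ] Y.carrier) (hf : f ∈ CB X.carrier Y.carrier)
    (h : ∀ (x : X.carrier) (a : A.alg), f (OperatorModule.act x a) = OperatorModule.act (f x) a) :
    X ⟶ Y := ⟨f, hf, h⟩

lemma hom_ext {X Y : OMod.{u} A} {f g : X ⟶ Y} (h : toLin f = toLin g) : f = g := Subtype.ext h

instance : (forget.{u} A).Faithful where
  map_injective h := hom_ext (congrArg Op.toLin h)

lemma ker_act_mem {X Y : OMod.{u} A} (f : X ⟶ Y) (x : X.carrier)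
    (hx : x ∈ LinearMap.ker (toLin f)) (a : A.alg) :
    OperatorModule.act x a ∈ LinearMap.ker (toLin f) := by
  rw [LinearMap.mem_ker] at *
  rw [toLin_act, hx, map_zero, LinearMap.zero_apply]

lemma closure_range_act_mem {X Y : OMod.{u} A} (f : X ⟶ Y) (y : Y.carrier)
    (hy : y ∈ (LinearMap.range (toLin f)).topologicalClosure) (a : A.alg) :
    OperatorModule.act y a ∈ (LinearMap.range (toLin f)).topologicalClosure := by
  refine map_mem_closure (f := fun y : Y.carrier => OperatorModule.act y a)
    (continuous_act_left a) hy ?_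
  rintro _ ⟨x, rfl⟩
  exact ⟨OperatorModule.act x a, toLin_act f x a⟩

instance {X Y : OMod.{u} A} (f : X ⟶ Y) : IsClosed (LinearMap.ker (toLin f) : Set X.carrier) :=
  isClosed_ker_of_mem_CB (toLin_mem f)

/-- The kernel of a module map. -/
noncomputable def kernelObj {X Y : OMod.{u} A} (f : X ⟶ Y) : OMod.{u} A :=
  letI := OperatorModule.ofSubmodule (LinearMap.ker (toLin f)) (ker_act_mem f)
  ⟨LinearMap.ker (toLin f)⟩

/-- The inclusion of the kernel. -/
noncomputable def kernelι {X Y : OMod.{u} A} (f : X ⟶ Y) : kernelObj f ⟶ X :=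
  ofHom (LinearMap.ker (toLin f)).subtype (subtype_mem_CB _) fun _ _ => rfl

lemma kernelι_comp {X Y : OMod.{u} A} (f : X ⟶ Y) : kernelι f ≫ f = 0 :=
  hom_ext <| LinearMap.ext fun x => x.2

instance {X Y : OMod.{u} A} (f : X ⟶ Y) : Mono (kernelι f) :=
  (forget A).mono_of_mono_map (inferInstanceAs (Mono (Op.kernelι ((forget A).map f))))

lemma comp_apply_eq_zero {X Y Z : OMod.{u} A} {f : X ⟶ Y} {g : Y ⟶ Z} (h : f ≫ g = 0)
    (x : X.carrier) : toLin g (toLin f x) = 0 :=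
  LinearMap.congr_fun (congrArg toLin h) x

/-- The universal property of the kernel. -/
noncomputable def kernelIsLimit {X Y : OMod.{u} A} (f : X ⟶ Y) :
    IsLimit (KernelFork.ofι (kernelι f) (kernelι_comp f)) :=
  KernelFork.IsLimit.ofι' _ _ fun k hk =>
    ⟨ofHom ((toLin k).codRestrict _ (comp_apply_eq_zero hk))
      (codRestrict_mem_CB _ (toLin_mem k) (comp_apply_eq_zero hk))
      fun x a => Subtype.ext (toLin_act k x a), rfl⟩

/-- The cokernel of a module map. -/
noncomputable def cokernelObj {X Y : OMod.{u} A} (f : X ⟶ Y) : OMod.{u} A :=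
  letI := OperatorModule.ofQuotient (LinearMap.range (toLin f)).topologicalClosure
    (closure_range_act_mem f)
  ⟨Y.carrier ⧸ (LinearMap.range (toLin f)).topologicalClosure⟩

/-- The projection onto the cokernel. -/
noncomputable def cokernelπ {X Y : OMod.{u} A} (f : X ⟶ Y) : Y ⟶ cokernelObj f :=
  ofHom (LinearMap.range (toLin f)).topologicalClosure.mkQ (mkQ_mem_CB _) fun _ _ => rfl

lemma comp_cokernelπ {X Y : OMod.{u} A} (f : X ⟶ Y) : f ≫ cokernelπ f = 0 :=
  hom_ext <| congrArg Op.toLin (Op.comp_cokernelπ ((forget A).map f))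

instance {X Y : OMod.{u} A} (f : X ⟶ Y) : Epi (cokernelπ f) :=
  (forget A).epi_of_epi_map (inferInstanceAs (Epi (Op.cokernelπ ((forget A).map f))))

lemma closure_range_le_ker {X Y Z : OMod.{u} A} {f : X ⟶ Y} {g : Y ⟶ Z} (h : f ≫ g = 0) :
    (LinearMap.range (toLin f)).topologicalClosure ≤ LinearMap.ker (toLin g) :=
  Op.closure_range_le_ker (f := (forget A).map f) (g := (forget A).map g)
    (Op.hom_ext (congrArg toLin h))

/-- The universal property of the cokernel. -/
noncomputable def cokernelIsColimit {X Y : OMod.{u} A} (f : X ⟶ Y) :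
    IsColimit (CokernelCofork.ofπ (cokernelπ f) (comp_cokernelπ f)) :=
  CokernelCofork.IsColimit.ofπ' _ _ fun k hk =>
    ⟨ofHom (Submodule.liftQ _ (toLin k) (closure_range_le_ker hk))
      (liftQ_mem_CB _ (toLin_mem k) _)
      (fun x a => by
        obtain ⟨x, rfl⟩ := Submodule.mkQ_surjective _ x
        exact toLin_act k x a), hom_ext (Submodule.liftQ_mkQ _ _ _)⟩

instance : HasKernels (OMod.{u} A) := ⟨fun f => ⟨_, kernelIsLimit f⟩⟩

instance : HasCokernels (OMod.{u} A) := ⟨fun f => ⟨_, cokernelIsColimit f⟩⟩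

instance : HasZeroObject (OMod.{u} A) :=
  ⟨⟨PUnit⟩, (IsZero.iff_id_eq_zero _).2 (hom_ext (LinearMap.ext fun _ => rfl))⟩

/-- The product of modules is a biproduct. -/
noncomputable def biprodBicone (X Y : OMod.{u} A) : BinaryBicone X Y where
  pt := ⟨X.carrier × Y.carrier⟩
  fst := ofHom (LinearMap.fst ℂ _ _) fst_mem_CB fun _ _ => rfl
  snd := ofHom (LinearMap.snd ℂ _ _) snd_mem_CB fun _ _ => rfl
  inl := ofHom (LinearMap.inl ℂ _ _) inl_mem_CB fun _ a =>
    Prod.ext rfl (LinearMap.congr_fun (map_zero OperatorModule.act) a).symm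
  inr := ofHom (LinearMap.inr ℂ _ _) inr_mem_CB fun _ a =>
    Prod.ext (LinearMap.congr_fun (map_zero OperatorModule.act) a).symm rfl

instance : HasBinaryBiproducts (OMod.{u} A) where
  has_binary_biproduct X Y := ⟨⟨biprodBicone X Y, isBinaryBilimitOfTotal _
    (hom_ext (LinearMap.ext fun x => Prod.ext (add_zero x.1) (zero_add x.2)))⟩⟩

/-- The underlying space of the kernel module is by construction the kernel in `Op`, so one limit
cone maps to a limit cone. -/
instance {X Y : OMod.{u} A} (f : X ⟶ Y) : PreservesLimit (parallelPair f 0) (forget A) :=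
  preservesLimit_of_preserves_limit_cone (kernelIsLimit f)
    ((KernelFork.isLimitMapConeEquiv _ _).symm (Op.kernelIsLimit ((forget A).map f)))

instance {X Y : OMod.{u} A} (f : X ⟶ Y) : PreservesColimit (parallelPair f 0) (forget A) :=
  preservesColimit_of_preserves_colimit_cocone (cokernelIsColimit f)
    ((CokernelCofork.isColimitMapCoconeEquiv _ _).symm
      (Op.cokernelIsColimit ((forget A).map f)))

instance : (forget.{u} A).ReflectsIsomorphisms where
  reflects {X Y} f hf := by
    obtain ⟨g, hg, h1, h2⟩ : ∃ g : Y.carrier →ₗ[ℂ] X.carrier, g ∈ CB Y.carrier X.carrier ∧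
        (∀ x, g (toLin f x) = x) ∧ ∀ y, toLin f (g y) = y := by
      obtain ⟨g, hg1, hg2⟩ := hf
      exact ⟨Op.toLin g, Op.toLin_mem g, LinearMap.congr_fun (congrArg Op.toLin hg1),
        LinearMap.congr_fun (congrArg Op.toLin hg2)⟩
    refine ⟨ofHom g hg fun y a => ?_, hom_ext (LinearMap.ext h1), hom_ext (LinearMap.ext h2)⟩
    -- The inverse is automatically a module map: `g y · a = g (f (g y · a)) = g (f (g y) · a) = g
    -- (y · a)`.
    rw [← h1 (OperatorModule.act (g y) a), toLin_act, h2]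

end OMod

lemma Emax_eq_comap : Emax (OMod.{u} A) = fun S => Emax Op.{u} (S.map (forget A)) :=
  funext fun S => propext (isKernelCokernelPair_map_iff (forget A) S).symm

/-- The splitting clause already lives in `Op`; only the kernel–cokernel clause has to cross the
forgetful functor. -/
lemma Erel_eq_comap : Erel.{u} A = fun S => Emin Op.{u} (S.map (forget A)) :=
  funext fun S => propext (and_congr_left fun _ =>
    (isKernelCokernelPair_map_iff (forget A) S).symm)

end OpMod

theorem mainTheorem4 {H : Type w} [NormedAddCommGroup H] [InnerProductSpace ℂ H]
    [CompleteSpace H] (A : OpMod.OperatorAlgebra H) :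
    OpMod.IsExactCategory (OpMod.Erel.{u} A) ∧
    OpMod.IsExactFunctor (OpMod.forget.{u} A)
      (OpMod.Emax (OpMod.OMod.{u} A)) (OpMod.Emax OpMod.Op.{u}) ∧
    OpMod.IsExactCategory (OpMod.Emin OpMod.Op.{u}) ∧
    OpMod.Erel.{u} A = OpMod.relativeClass (OpMod.forget.{u} A)
      (OpMod.Emax (OpMod.OMod.{u} A)) (OpMod.Emin OpMod.Op.{u}) := by
  have hmax := OpMod.Op.isExactCategory_Emax.{u}
  have hmin := OpMod.isExactCategory_Emin OpMod.Op.{u}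
  refine ⟨?_, ⟨?_, hmax, fun S hS => ?_⟩, hmin, ?_⟩
  · rw [OpMod.Erel_eq_comap]
    exact OpMod.isExactCategory_comap (OpMod.forget A) hmin.isExactStructure
  · rw [OpMod.Emax_eq_comap]
    exact OpMod.isExactCategory_comap (OpMod.forget A) hmax.isExactStructure
  · rwa [OpMod.Emax_eq_comap] at hS
  · rw [OpMod.Erel_eq_comap]
    ext S
    refine ⟨fun h => ⟨?_, h⟩, fun h => h.2⟩
    exact (OpMod.isKernelCokernelPair_map_iff (OpMod.forget A) S).1 h.1
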